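/- Let $Y$ be a locally compact metrizable space and let $\alpha\colon\mathbb R\times Y\to Y$ be a continuous flow without fixed points, i.e. for every $y\in Y$ there is $t\in\mathbb R$ with $\alpha_t(y)\neq y$. **Groupoids.** A topological groupoid is a small category in which all arrows are invertible, whose set of arrows $G$ (containing the units $G^0$) carries a topology for which multiplication on composable pairs ($d(x)=r(y)$) and inversion are continuous. A fiberwise groupoid covering $\pi\colon G\to H$ between topological groupoids is a surjective groupoid homomorphism that is a local homeomorphism and restricts to a homeomorphism $G^0\to H^0$. The transformation groupoid $Y\rtimes\mathbb R$ is $Y\times\mathbb R$ with $r(y,t)=(y,0)$, $d(y,t)=(\alpha_{-t}(y),0)$, $(y,t)(\alpha_{-t}(y),s)=(y,t+s)$ and $(y,t)^{-1}=(\alpha_{-t}(y),-t)$. **Foliations.** A line foliation chart on $Y$ is a triple $(U,T,\varphi)$ with $U\subseteq Y$ open, $T$ locally compact metrizable and $\varphi\colon U\to\mathbb R\times T$ a homeomorphism; its plaques are the sets $\varphi^{-1}(\mathbb R\times\{x\})$. Two charts are coherent if every intersection of a plaque of one with a plaque of the other is open in both. A foliated atlas is a family of pairwise coherent charts covering $Y$.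 It defines a line foliation $\mathcal F$, whose charts are all charts coherent with the atlas. The leaves are the classes of the equivalence relation generated by lying on a common plaque. **Holonomy groupoid.** Let $\gamma\colon[0,1]\to Y$ be a continuous path with image in one leaf, and let $T,T'$ be the transversals of charts of $\mathcal F$ at $\gamma(0)$ and $\gamma(1)$. Composing along finite chains of charts the canonical transition maps between transversals at a common point of $\gamma$, and the identity of the transversal of a chart while $\gamma$ stays in one plaque, gives a germ $[H_\gamma]$ of a map from $T$ to $T'$ at the base points. Two leaf paths are in the same holonomy class if they have the same endpoints and the same holonomy germs. The holonomy groupoid $G_{\mathcal F}$ is the set of holonomy classes $[\gamma]_{\mathrm{hol}}$ of leaf paths, with $r([\gamma]_{\mathrm{hol}})=\gamma(0)$ and $d([\gamma]_{\mathrm{hol}})=\gamma(1)$ (points being identified with classes of constant paths), multiplication given by concatenation and inverse by reversal. Its topology is generated by the sets $V(U_1,\dots,U_n)$, over finite sequences of charts of $\mathcal F$ with domains $U_1,\dots,U_n$, where $V(U_1,\dots,U_n)$ consists of the classes of all leaf paths $\gamma'$ for which there are $0=t_0<\dots<t_n=1$ with $\gamma'([t_{i-1},t_i])\subseteq U_i$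 for all $i$. **The induced foliation.** A tube of $\alpha$ is the image $B$ of an embedding $S\times[-\frac l2,\frac l2]\to Y$, $(y,t)\mapsto\alpha_t(y)$, with $S\subseteq Y$ compact and $l>0$. An open tube chart has domain the interior $B^o$ and transversal the open central slice $S\cap B^o$, and sends $\alpha_t(y)$, for $y\in S\cap B^o$ and $|t|<\frac l2$, to $(\theta(t),y)$, where $\theta\colon(-\frac l2,\frac l2)\to\mathbb R$ is an increasing bijection. **Statement.** The open tube charts form a foliated atlas of $Y$. Let $\mathcal F$ be the line foliation it defines. For $y\in Y$ and $t\in\mathbb R$ the path $\gamma_{y,t}(s)=\alpha_{-ts}(y)$, $s\in[0,1]$, lies in one leaf of $\mathcal F$; the groupoids $Y\rtimes\mathbb R$ and $G_{\mathcal F}$ are topological groupoids; and the map $$\pi\colon Y\rtimes\mathbb R\to G_{\mathcal F},\qquad \pi(y,t)=[\gamma_{y,t}]_{\mathrm{hol}},$$ is a fiberwise groupoid covering. -/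

import Mathlib

open Set Filter Topology

universe u v

noncomputable section

/-! ### Topological groupoids and fiberwise groupoid coverings -/

/-- The operations of a groupoid whose set of arrows is `G`: the domain and range maps (with values
in the units, which are themselves arrows), the multiplication of the pairs `(x, y)` with
`d x = r y`, and the inversion. The laws are `GroupoidData.IsTopologicalGroupoid`. -/
structure GroupoidData (G : Type u) where
  d : G → G
  r : G → G
  mul : ∀ x y : G, d x = r y → G
  inv : G → G

namespace GroupoidData

/-- The unit space. -/
def unitSpace {G : Type u} (A : GroupoidData G) : Set G := {x | A.d x = x ∧ A.r x = x}

/-- The operations make `G` a small category in which all arrows are invertible, and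
multiplication (on the space of composable pairs) and inversion are continuous. -/
structure IsTopologicalGroupoid {G : Type u} [TopologicalSpace G] (A : GroupoidData G) :
    Prop where
  d_mem : ∀ x, A.d x ∈ A.unitSpace
  r_mem : ∀ x, A.r x ∈ A.unitSpace
  d_mul : ∀ x y (h : A.d x = A.r y), A.d (A.mul x y h) = A.d y
  r_mul : ∀ x y (h : A.d x = A.r y), A.r (A.mul x y h) = A.r x
  unit_mul : ∀ x (h : A.d (A.r x) = A.r x), A.mul (A.r x) x h = x
  mul_unit : ∀ x (h : A.d x = A.r (A.d x)), A.mul x (A.d x) h = x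
  mul_assoc : ∀ x y z (hxy : A.d x = A.r y) (hyz : A.d y = A.r z)
    (h₁ : A.d (A.mul x y hxy) = A.r z) (h₂ : A.d x = A.r (A.mul y z hyz)),
    A.mul (A.mul x y hxy) z h₁ = A.mul x (A.mul y z hyz) h₂
  d_inv : ∀ x, A.d (A.inv x) = A.r x
  r_inv : ∀ x, A.r (A.inv x) = A.d x
  inv_mul : ∀ x (h : A.d (A.inv x) = A.r x), A.mul (A.inv x) x h = A.d x
  mul_inv : ∀ x (h : A.d x = A.r (A.inv x)), A.mul x (A.inv x) h = A.r x
  continuous_mul : Continuous fun p : {p : G × G // A.d p.1 = A.r p.2} =>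
    A.mul p.1.1 p.1.2 p.2
  continuous_inv : Continuous A.inv

end GroupoidData

/-- `π` is a fiberwise groupoid covering map between the topological groupoids `A` and `B`: a
surjective groupoid homomorphism which is a local homeomorphism and restricts to a homeomorphism
between the unit spaces. -/
structure IsFiberwiseGroupoidCovering {G : Type u} {H : Type v} [TopologicalSpace G]
    [TopologicalSpace H] (A : GroupoidData G) (B : GroupoidData H) (π : G → H) : Prop where
  source_groupoid : A.IsTopologicalGroupoid
  target_groupoid : B.IsTopologicalGroupoid
  map_d : ∀ x, π (A.d x) = B.d (π x)
  map_r : ∀ x, π (A.r x) = B.r (π x)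
  map_mul : ∀ x y (h : A.d x = A.r y) (h' : B.d (π x) = B.r (π y)),
    π (A.mul x y h) = B.mul (π x) (π y) h'
  unitSpace_homeo : ∃ e : A.unitSpace ≃ₜ B.unitSpace, ∀ u : A.unitSpace, (e u : H) = π u
  surjective : Function.Surjective π
  isLocalHomeomorph : IsLocalHomeomorph π

/-- The transformation groupoid `Y ⋊ ℝ` of a flow `α`: the space is `Y × ℝ`, the units are the
pairs `(y, 0)`, `r (y, t) = (y, 0)`, `d (y, t) = (α_{-t} y, 0)` and
`(y, t) (α_{-t} y, s) = (y, t + s)`. -/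
def transformationGroupoid {Y : Type u} [TopologicalSpace Y] (α : Flow ℝ Y) :
    GroupoidData (Y × ℝ) where
  d p := (α (-p.2) p.1, 0)
  r p := (p.1, 0)
  mul p q _ := (p.1, p.2 + q.2)
  inv p := (α (-p.2) p.1, -p.2)

/-! ### Line foliations -/

/-- A line foliation chart `(U, T, φ)`: `T` is a locally compact metrizable space and `φ` is a
homeomorphism of the open set `U ⊆ Y` onto `ℝ × T`. (Values of `φ` off `U` are irrelevant.) -/
structure LineChart (Y : Type u) [TopologicalSpace Y] where
  T : Type u
  [topT : TopologicalSpace T]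
  [lcT : LocallyCompactSpace T]
  [metT : TopologicalSpace.MetrizableSpace T]
  φ : OpenPartialHomeomorph Y (ℝ × T)
  target_eq : φ.target = univ

attribute [instance] LineChart.topT LineChart.lcT LineChart.metT

namespace LineChart

variable {Y : Type u} [TopologicalSpace Y]

/-- The domain `U` of the chart. -/
def dom (c : LineChart Y) : Set Y := c.φ.source

/-- The coordinate in the transversal. For `y ∈ U` it is the base point of `T` as a transversal
at `y`. -/
def base (c : LineChart Y) (y : Y) : c.T := (c.φ y).2

/-- The plaque over `x`, i.e. `φ⁻¹ (ℝ × {x})`. -/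
def plaque (c : LineChart Y) (x : c.T) : Set Y := {y | y ∈ c.dom ∧ c.base y = x}

/-- Two charts are coherent if the intersection of any two of their plaques is open in both. -/
def Coherent (c c' : LineChart Y) : Prop :=
  ∀ (x : c.T) (x' : c'.T),
    IsOpen ((Subtype.val : c.plaque x → Y) ⁻¹' c'.plaque x') ∧
    IsOpen ((Subtype.val : c'.plaque x' → Y) ⁻¹' c.plaque x)

/-- The canonical map between the transversals of two charts at a common point `y`: `x` is sent
to the transverse `c'`-coordinate of the point of `c` with coordinates `(s, x)`, where `s` is the
first coordinate of `y`. Only its germ at `c.base y` is meaningful. -/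
def transition (c c' : LineChart Y) (y : Y) : c.T → c'.T :=
  fun x => c'.base (c.φ.symm ((c.φ y).1, x))

theorem isOpen_preimage_iff {S S' : Set Y} :
    IsOpen ((Subtype.val : S → Y) ⁻¹' S') ↔ ∀ p ∈ S, p ∈ S' → S' ∈ 𝓝[S] p := by
  rw [isOpen_iff_mem_nhds]
  constructor
  · intro h p hp hp'
    have := h ⟨p, hp⟩ hp'
    rwa [mem_nhds_subtype_iff_nhdsWithin, Subtype.image_preimage_coe,
      inter_comm, inter_mem_iff, and_iff_left self_mem_nhdsWithin] at this
  · rintro h ⟨p, hp⟩ hp'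
    rw [mem_nhds_subtype_iff_nhdsWithin, Subtype.image_preimage_coe]
    exact inter_mem self_mem_nhdsWithin (h p hp hp')

theorem Coherent.symm {c c' : LineChart Y} (h : c.Coherent c') : c'.Coherent c :=
  fun x x' => (h x' x).symm

theorem Coherent.mem {c c' : LineChart Y} (h : c.Coherent c') {p : Y} (hp : p ∈ c.dom)
    (hp' : p ∈ c'.dom) : c'.plaque (c'.base p) ∈ 𝓝[c.plaque (c.base p)] p :=
  isOpen_preimage_iff.1 (h _ _).1 p ⟨hp, rfl⟩ ⟨hp', rfl⟩

theorem coherent_of_mem {c c' : LineChart Y}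
    (h : ∀ p ∈ c.dom, p ∈ c'.dom → c'.plaque (c'.base p) ∈ 𝓝[c.plaque (c.base p)] p)
    (h' : ∀ p ∈ c.dom, p ∈ c'.dom → c.plaque (c.base p) ∈ 𝓝[c'.plaque (c'.base p)] p) :
    c.Coherent c' := by
  intro x x'
  rw [isOpen_preimage_iff, isOpen_preimage_iff]
  constructor
  · rintro p ⟨hp, rfl⟩ ⟨hp', rfl⟩
    exact h p hp hp'
  · rintro p ⟨hp', rfl⟩ ⟨hp, rfl⟩
    exact h' p hp hp'

theorem Coherent.trans {a b c : LineChart Y} (h₁ : a.Coherent b) (h₂ : b.Coherent c) {p : Y}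
    (ha : p ∈ a.dom) (hb : p ∈ b.dom) (hc : p ∈ c.dom) :
    c.plaque (c.base p) ∈ 𝓝[a.plaque (a.base p)] p := by
  have h1 := h₁.mem ha hb
  have h2 := h₂.mem hb hc
  rw [mem_nhdsWithin_iff_eventually] at *
  filter_upwards [h1, h2] with q hq hq' hqa using hq' (hq hqa)

theorem base_symm (c : LineChart Y) (s : ℝ) (x : c.T) : c.base (c.φ.symm (s, x)) = x := by
  unfold base
  rw [c.φ.right_inv (by rw [c.target_eq]; trivial)]

theorem symm_mem (c : LineChart Y) (z : ℝ × c.T) : c.φ.symm z ∈ c.dom :=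
  c.φ.map_target (by rw [c.target_eq]; trivial)

theorem symm_base (c : LineChart Y) {y : Y} (hy : y ∈ c.dom) :
    c.φ.symm ((c.φ y).1, c.base y) = y := c.φ.left_inv hy

theorem continuous_symm (c : LineChart Y) : Continuous c.φ.symm := by
  have := c.φ.symm.continuousOn
  rwa [OpenPartialHomeomorph.symm_source, c.target_eq, continuousOn_univ] at this

theorem transition_self (c : LineChart Y) (y : Y) : c.transition c y = id :=
  funext fun x => c.base_symm _ x

theorem transition_base {c c' : LineChart Y} {y : Y} (hy : y ∈ c.dom) :
    c.transition c' y (c.base y) = c'.base y := by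
  unfold transition
  rw [c.symm_base hy]

theorem transition_continuousAt {c c' : LineChart Y} {y : Y} (hy : y ∈ c.dom)
    (hy' : y ∈ c'.dom) : ContinuousAt (c.transition c' y) (c.base y) := by
  have h1 : ContinuousAt (fun x => c.φ.symm ((c.φ y).1, x)) (c.base y) :=
    (c.continuous_symm.comp (by fun_prop)).continuousAt
  have h2 : ContinuousAt c'.base y := continuous_snd.continuousAt.comp (c'.φ.continuousAt hy')
  have h3 : ContinuousAt c'.base (c.φ.symm ((c.φ y).1, c.base y)) := by
    rwa [c.symm_base hy]
  exact ContinuousAt.comp (g := c'.base) h3 h1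

/-- For coherent charts the transition germs in the two directions are inverse to each other. -/
theorem transition_inverse {c c' : LineChart Y} (h : c.Coherent c') {y : Y} (hy : y ∈ c.dom)
    (hy' : y ∈ c'.dom) :
    ∀ᶠ x in 𝓝 (c.base y), c'.transition c y (c.transition c' y x) = x := by
  set s : ℝ := (c.φ y).1 with hs
  set s' : ℝ := (c'.φ y).1 with hs'
  have hyz : c'.φ.symm (s', c'.base y) = y := c'.symm_base hy'
  -- a box around the point `y` in the second chart that lies in the domain of the first one
  have hO : {z : ℝ × c'.T | c'.φ.symm z ∈ c.dom} ∈ 𝓝 (s', c'.base y) := by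
    apply c'.continuous_symm.continuousAt.preimage_mem_nhds
    rw [hyz]
    exact c.φ.open_source.mem_nhds hy
  rw [nhds_prod_eq, Filter.mem_prod_iff] at hO
  obtain ⟨J, hJ, V, hV, hJV⟩ := hO
  obtain ⟨ε, hε, hεJ⟩ := Metric.mem_nhds_iff.1 hJ
  have hcont : ContinuousAt (fun x => c.φ.symm (s, x)) (c.base y) :=
    (c.continuous_symm.comp (by fun_prop)).continuousAt
  have hval : c.φ.symm (s, c.base y) = y := c.symm_base hy
  have e1 : ∀ᶠ x in 𝓝 (c.base y), c.φ.symm (s, x) ∈ c'.dom :=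
    hcont.eventually (by
      beta_reduce
      rw [hval]
      exact c'.φ.open_source.mem_nhds hy')
  have e2 : ∀ᶠ x in 𝓝 (c.base y), (c'.φ (c.φ.symm (s, x))).1 ∈ Metric.ball s' ε := by
    apply hcont.eventually (p := fun q => (c'.φ q).1 ∈ Metric.ball s' ε)
    beta_reduce
    rw [hval]
    exact (continuous_fst.continuousAt.comp (c'.φ.continuousAt hy')).eventually
      (Metric.ball_mem_nhds _ hε)
  have e3 : ∀ᶠ x in 𝓝 (c.base y), c.transition c' y x ∈ V :=
    (transition_continuousAt hy hy').eventually (by rw [transition_base hy]; exact hV)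
  filter_upwards [e1, e2, e3] with x h1 h2 h3
  set x' := c.transition c' y x with hx'
  let g : Metric.ball s' ε → c.T := fun σ => c.base (c'.φ.symm (σ, x'))
  have hg : IsLocallyConstant g := by
    rw [IsLocallyConstant.iff_eventually_eq]
    intro σ
    have hp : c'.φ.symm (σ, x') ∈ c.dom := hJV (mk_mem_prod (hεJ σ.2) h3)
    have hp' : c'.φ.symm (σ, x') ∈ c'.dom := c'.symm_mem _
    have hm := h.symm.mem hp' hp
    rw [c'.base_symm] at hm
    have ht : Tendsto (fun τ : Metric.ball s' ε => c'.φ.symm ((τ : ℝ), x')) (𝓝 σ)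
        (𝓝[c'.plaque x'] (c'.φ.symm (σ, x'))) := by
      rw [tendsto_nhdsWithin_iff]
      refine ⟨?_, Eventually.of_forall fun τ => ⟨c'.symm_mem _, c'.base_symm _ _⟩⟩
      exact ((c'.continuous_symm.comp (by fun_prop)).tendsto σ)
    filter_upwards [ht hm] with τ hτ using hτ.2
  have : PreconnectedSpace (Metric.ball s' ε) :=
    Subtype.preconnectedSpace (convex_ball s' ε).isPreconnected
  have key := hg.apply_eq_of_preconnectedSpace ⟨s', Metric.mem_ball_self hε⟩ ⟨_, h2⟩
  change c.base (c'.φ.symm (s', x')) = _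
  refine key.trans ?_
  change c.base (c'.φ.symm ((c'.φ (c.φ.symm (s, x))).1, c'.base (c.φ.symm (s, x)))) = x
  rw [c'.symm_base h1, c.base_symm]

end LineChart

/-- A foliated atlas: a collection of pairwise coherent charts that cover `Y`. -/
structure IsFoliatedAtlas {Y : Type u} [TopologicalSpace Y] (A : Set (LineChart Y)) : Prop where
  covers : ∀ y, ∃ c ∈ A, y ∈ c.dom
  coherent : ∀ c ∈ A, ∀ c' ∈ A, c.Coherent c'

/-- A line foliation of `Y`. Two foliated atlases give the same foliation if their union is a
foliated atlas, so a foliation is the same thing as a maximal foliated atlas. -/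
structure LineFoliation (Y : Type u) [TopologicalSpace Y] where
  charts : Set (LineChart Y)
  isFoliatedAtlas : IsFoliatedAtlas charts
  maximal : ∀ c, (∀ c' ∈ charts, c.Coherent c') → c ∈ charts

/-- The line foliation given by a foliated atlas `A`: its charts are the charts coherent with
those of `A`. -/
def IsFoliatedAtlas.foliation {Y : Type u} [TopologicalSpace Y] {A : Set (LineChart Y)}
    (hA : IsFoliatedAtlas A) : LineFoliation Y where
  charts := {c | ∀ a ∈ A, c.Coherent a}
  isFoliatedAtlas := by
    refine ⟨fun y => ?_, fun c hc c' hc' => ?_⟩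
    · obtain ⟨c, hc, hy⟩ := hA.covers y
      exact ⟨c, hA.coherent c hc, hy⟩
    · refine LineChart.coherent_of_mem (fun p hp hp' => ?_) (fun p hp hp' => ?_)
      · obtain ⟨a, ha, hpa⟩ := hA.covers p
        exact (hc a ha).trans (hc' a ha).symm hp hpa hp'
      · obtain ⟨a, ha, hpa⟩ := hA.covers p
        exact (hc' a ha).trans (hc a ha).symm hp' hpa hp
  maximal := fun c hc a ha => hc a (hA.coherent a ha)

namespace LineFoliation

variable {Y : Type u} [TopologicalSpace Y] (F : LineFoliation Y)

/-- Being on the same leaf: the equivalence relation generated by being on the same plaque of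
a chart. -/
def SameLeaf : Y → Y → Prop :=
  Relation.EqvGen fun y z => ∃ c ∈ F.charts, ∃ x : c.T, y ∈ c.plaque x ∧ z ∈ c.plaque x

/-- The path is contained in one leaf. -/
def IsLeafPath {x y : Y} (γ : Path x y) : Prop := ∀ s, F.SameLeaf x (γ s)

/-- `F.IsHolonomyMap f c a c' b h`: the map `h` is obtained by transport along `f` from time `a`
to time `b`, from the transversal of `c` at `f a` to the transversal of `c'` at `f b`, through some
chain of charts. It is a composition of transition maps between two charts at a common point of the
curve, and of identity maps of the transversal of a chart while the curve stays on one plaque of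
that chart. Only the germ of `h` at the base point is meaningful. -/
inductive IsHolonomyMap (f : ℝ → Y) :
    (c : LineChart Y) → ℝ → (c' : LineChart Y) → ℝ → (c.T → c'.T) → Prop
  | transition (c c' : LineChart Y) (a : ℝ) (hc : c ∈ F.charts) (hc' : c' ∈ F.charts)
      (h : f a ∈ c.dom) (h' : f a ∈ c'.dom) : IsHolonomyMap f c a c' a (c.transition c' (f a))
  | plaque (c : LineChart Y) (a b : ℝ) (hc : c ∈ F.charts) (hab : a ≤ b) (x : c.T)
      (h : ∀ s ∈ Icc a b, f s ∈ c.plaque x) : IsHolonomyMap f c a c b id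
  | comp {c c' c'' : LineChart Y} {a b e : ℝ} {h : c.T → c'.T} {k : c'.T → c''.T} :
      IsHolonomyMap f c a c' b h → IsHolonomyMap f c' b c'' e k →
      IsHolonomyMap f c a c'' e (k ∘ h)

/-- The germs of the holonomy `H_γ` of the path `γ`, for the transversals of `c` at `x` and of
`c'` at `y`, over all possible choices of chains of charts (they all give the same germ). -/
def holonomyGerms {x y : Y} (γ : Path x y) (c c' : LineChart Y) :
    Set (Filter.Germ (𝓝 (c.base x)) c'.T) :=
  {g | ∃ h : c.T → c'.T, F.IsHolonomyMap γ.extend c 0 c' 1 h ∧ (h : Filter.Germ _ _) = g}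

/-- Two leaf paths with the same endpoints are in the same holonomy class if `[H_γ] = [H_γ']`
with respect to any transversals at the endpoints. -/
def holonomySetoid (x y : Y) : Setoid {γ : Path x y // F.IsLeafPath γ} where
  r γ γ' := ∀ c ∈ F.charts, ∀ c' ∈ F.charts, x ∈ c.dom → y ∈ c'.dom →
    F.holonomyGerms γ.1 c c' = F.holonomyGerms γ'.1 c c'
  iseqv := ⟨fun _ _ _ _ _ _ _ => rfl, fun h c hc c' hc' hx hy => (h c hc c' hc' hx hy).symm,
    fun h k c hc c' hc' hx hy => (h c hc c' hc' hx hy).trans (k c hc c' hc' hx hy)⟩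

/-- The set of holonomy classes of leaf paths from `x` to `y`. -/
def HolonomyClass (x y : Y) : Type u := Quotient (F.holonomySetoid x y)

/-- The holonomy class of a leaf path. -/
def holonomyClass {x y : Y} (γ : Path x y) (hγ : F.IsLeafPath γ) : F.HolonomyClass x y :=
  Quotient.mk (F.holonomySetoid x y) ⟨γ, hγ⟩

/-! #### Compatibility of holonomy classes with concatenation and reversal -/

variable {F}

theorem SameLeaf.symm {x y : Y} (h : F.SameLeaf x y) : F.SameLeaf y x := Relation.EqvGen.symm _ _ h

theorem SameLeaf.trans {x y z : Y} (h : F.SameLeaf x y) (k : F.SameLeaf y z) : F.SameLeaf x z :=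
  Relation.EqvGen.trans _ _ _ h k

theorem IsLeafPath.refl (x : Y) : F.IsLeafPath (Path.refl x) :=
  fun _ => Relation.EqvGen.refl _

theorem IsLeafPath.target {x y : Y} {γ : Path x y} (h : F.IsLeafPath γ) : F.SameLeaf x y := by
  simpa using h 1

theorem IsLeafPath.symm {x y : Y} {γ : Path x y} (h : F.IsLeafPath γ) : F.IsLeafPath γ.symm :=
  fun s => h.target.symm.trans (h (unitInterval.symm s))

theorem IsLeafPath.trans {x y z : Y} {γ : Path x y} {γ' : Path y z} (h : F.IsLeafPath γ)
    (h' : F.IsLeafPath γ') : F.IsLeafPath (γ.trans γ') := by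
  intro s
  rw [Path.trans_apply]
  split_ifs
  · exact h _
  · exact h.target.trans (h' _)

namespace IsHolonomyMap

variable {f g : ℝ → Y} {c c' : LineChart Y} {a b : ℝ} {h : c.T → c'.T}

theorem le (H : F.IsHolonomyMap f c a c' b h) : a ≤ b := by
  induction H with
  | transition => exact le_rfl
  | plaque _ _ _ _ hab => exact hab
  | comp _ _ h1 h2 => exact h1.trans h2

theorem left (H : F.IsHolonomyMap f c a c' b h) : c ∈ F.charts ∧ f a ∈ c.dom := by
  induction H with
  | transition _ _ _ hc _ h => exact ⟨hc, h⟩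
  | plaque c a b hc hab x h => exact ⟨hc, (h a ⟨le_rfl, hab⟩).1⟩
  | comp _ _ h1 h2 => exact h1

theorem right (H : F.IsHolonomyMap f c a c' b h) : c' ∈ F.charts ∧ f b ∈ c'.dom := by
  induction H with
  | transition _ _ _ _ hc' _ h => exact ⟨hc', h⟩
  | plaque c a b hc hab x h => exact ⟨hc, (h b ⟨hab, le_rfl⟩).1⟩
  | comp _ _ h1 h2 => exact h2

theorem map_base (H : F.IsHolonomyMap f c a c' b h) : h (c.base (f a)) = c'.base (f b) := by
  induction H with
  | transition c c' a hc hc' h h' => exact LineChart.transition_base h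
  | plaque c a b hc hab x h =>
    exact (h a ⟨le_rfl, hab⟩).2.trans (h b ⟨hab, le_rfl⟩).2.symm
  | comp _ _ h1 h2 => rw [Function.comp_apply, h1, h2]

theorem continuousAt (H : F.IsHolonomyMap f c a c' b h) : ContinuousAt h (c.base (f a)) := by
  induction H with
  | transition c c' a hc hc' h h' => exact LineChart.transition_continuousAt h h'
  | plaque => exact continuousAt_id
  | comp H1 H2 h1 h2 =>
    refine ContinuousAt.comp ?_ h1
    rwa [H1.map_base]

theorem tendsto (H : F.IsHolonomyMap f c a c' b h) :
    Tendsto h (𝓝 (c.base (f a))) (𝓝 (c'.base (f b))) := by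
  rw [← H.map_base]
  exact H.continuousAt

theorem congr (H : F.IsHolonomyMap f c a c' b h) (hfg : ∀ s ∈ Icc a b, f s = g s) :
    F.IsHolonomyMap g c a c' b h := by
  induction H with
  | transition c c' a hc hc' h h' =>
    have e := hfg a ⟨le_rfl, le_rfl⟩
    rw [e]
    exact transition c c' a hc hc' (e ▸ h) (e ▸ h')
  | plaque c a b hc hab x h =>
    exact plaque c a b hc hab x fun s hs => hfg s hs ▸ h s hs
  | comp H1 H2 h1 h2 =>
    exact comp (h1 fun s hs => hfg s ⟨hs.1, hs.2.trans H2.le⟩)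
      (h2 fun s hs => hfg s ⟨H1.le.trans hs.1, hs.2⟩)

theorem affine (m q : ℝ) (hm : 0 < m) (hfg : ∀ s, g (m * s + q) = f s)
    (H : F.IsHolonomyMap f c a c' b h) :
    F.IsHolonomyMap g c (m * a + q) c' (m * b + q) h := by
  induction H with
  | transition c c' a hc hc' h h' =>
    rw [← hfg a] at h h' ⊢
    exact transition c c' _ hc hc' h h'
  | plaque c a b hc hab x h =>
    refine plaque c _ _ hc (by nlinarith) x fun s hs => ?_
    have e : s = m * ((s - q) / m) + q := by field_simp; ring
    rw [e, hfg]
    refine h _ ⟨?_, ?_⟩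
    · rw [le_div_iff₀ hm]; linarith [hs.1]
    · rw [div_le_iff₀ hm]; linarith [hs.2]
  | comp H1 H2 h1 h2 => exact comp h1 h2

theorem split (H : F.IsHolonomyMap f c a c' b h) {m : ℝ} (ham : a ≤ m) (hmb : m ≤ b) :
    ∃ (e : LineChart Y) (k : c.T → e.T) (l : e.T → c'.T), F.IsHolonomyMap f c a e m k ∧
      F.IsHolonomyMap f e m c' b l ∧ h = l ∘ k := by
  induction H with
  | transition c c' a hc hc' h h' =>
    obtain rfl : m = a := le_antisymm hmb ham
    refine ⟨c, _, _, transition c c m hc hc h h, transition c c' m hc hc' h h', ?_⟩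
    rw [LineChart.transition_self]
    rfl
  | plaque c a b hc hab x h =>
    exact ⟨c, id, id, plaque c a m hc ham x fun s hs => h s ⟨hs.1, hs.2.trans hmb⟩,
      plaque c m b hc hmb x fun s hs => h s ⟨ham.trans hs.1, hs.2⟩, rfl⟩
  | @comp c c' c'' a b d h k H1 H2 h1 h2 =>
    rcases le_total m b with hm | hm
    · obtain ⟨e, p, q, hp, hq, rfl⟩ := h1 ham hm
      exact ⟨e, p, k ∘ q, hp, comp hq H2, rfl⟩
    · obtain ⟨e, p, q, hp, hq, rfl⟩ := h2 hm hmb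
      exact ⟨e, p ∘ h, q, comp H1 hp, hq, rfl⟩

theorem reverse (hfg : ∀ s, g (1 - s) = f s) (H : F.IsHolonomyMap f c a c' b h) :
    ∃ k : c'.T → c.T, F.IsHolonomyMap g c' (1 - b) c (1 - a) k ∧
      (∀ᶠ x in 𝓝 (c.base (f a)), k (h x) = x) ∧
      ∀ᶠ x in 𝓝 (c'.base (f b)), h (k x) = x := by
  induction H with
  | transition c c' a hc hc' h h' =>
    refine ⟨c'.transition c (f a), ?_,
      LineChart.transition_inverse (F.isFoliatedAtlas.coherent c hc c' hc') h h',
      LineChart.transition_inverse (F.isFoliatedAtlas.coherent c' hc' c hc) h' h⟩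
    rw [← hfg a] at h h' ⊢
    exact transition c' c _ hc' hc h' h
  | plaque c a b hc hab x h =>
    refine ⟨id, plaque c _ _ hc (by linarith) x fun s hs => ?_, Eventually.of_forall fun _ => rfl,
      Eventually.of_forall fun _ => rfl⟩
    have e : s = 1 - (1 - s) := by ring
    rw [e, hfg]
    exact h _ ⟨by linarith [hs.2], by linarith [hs.1]⟩
  | @comp c c' c'' a b d h k H1 H2 h1 h2 =>
    obtain ⟨p, hp, p1, p2⟩ := h1
    obtain ⟨q, hq, q1, q2⟩ := h2
    refine ⟨p ∘ q, comp hq hp, ?_, ?_⟩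
    · filter_upwards [p1, H1.tendsto.eventually q1] with x hx hx'
      simp only [Function.comp_apply]
      rw [hx', hx]
    · have ht := hq.tendsto
      have e1 : g (1 - b) = f b := hfg b
      have e2 : g (1 - d) = f d := hfg d
      rw [e1, e2] at ht
      filter_upwards [q2, ht.eventually p2] with x hx hx'
      simp only [Function.comp_apply]
      rw [hx', hx]

end IsHolonomyMap

theorem mem_holonomyGerms_trans {x y z : Y} (γ : Path x y) (γ' : Path y z) (c c'' : LineChart Y)
    (g : Filter.Germ (𝓝 (c.base x)) c''.T) :
    g ∈ F.holonomyGerms (γ.trans γ') c c'' ↔ ∃ (c' : LineChart Y) (h : c.T → c'.T)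
      (k : c'.T → c''.T), F.IsHolonomyMap γ.extend c 0 c' 1 h ∧
        F.IsHolonomyMap γ'.extend c' 0 c'' 1 k ∧ ((k ∘ h : c.T → c''.T) : Filter.Germ _ _) = g := by
  have e1 : ∀ s ∈ Icc (0 : ℝ) (1 / 2), (γ.trans γ').extend s = γ.extend (2 * s) :=
    fun s hs => Path.extend_trans_of_le_half _ _ hs.2
  have e2 : ∀ s ∈ Icc (1 / 2 : ℝ) 1, (γ.trans γ').extend s = γ'.extend (2 * s - 1) :=
    fun s hs => Path.extend_trans_of_half_le _ _ hs.1
  constructor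
  · rintro ⟨h, H, rfl⟩
    obtain ⟨c', k, l, hk, hl, rfl⟩ := H.split (m := 1 / 2) (by norm_num) (by norm_num)
    refine ⟨c', k, l, ?_, ?_, rfl⟩
    · have := (hk.congr e1).affine (g := γ.extend) 2 0 (by norm_num) (fun s => by simp)
      norm_num at this
      exact this
    · have := (hl.congr e2).affine (g := γ'.extend) 2 (-1) (by norm_num)
        (fun s => by rw [sub_eq_add_neg])
      norm_num at this
      exact this
  · rintro ⟨c', h, k, hh, hk, rfl⟩
    refine ⟨k ∘ h, IsHolonomyMap.comp (b := 1 / 2) (c' := c') ?_ ?_, rfl⟩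
    · have := hh.affine (g := fun s => γ.extend (2 * s)) (1 / 2) 0 (by norm_num)
        (fun s => by congr 1; ring)
      norm_num at this
      exact IsHolonomyMap.congr (by norm_num; exact this) fun s hs => (e1 s hs).symm
    · have := hk.affine (g := fun s => γ'.extend (2 * s - 1)) (1 / 2) (1 / 2) (by norm_num)
        (fun s => by congr 1; ring)
      norm_num at this
      exact IsHolonomyMap.congr (by norm_num; exact this) fun s hs => (e2 s hs).symm

theorem exists_of_equiv {x y : Y} {γ γ' : {γ : Path x y // F.IsLeafPath γ}}
    (h : (F.holonomySetoid x y).r γ γ') {c c' : LineChart Y} {k : c.T → c'.T}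
    (hk : F.IsHolonomyMap γ.1.extend c 0 c' 1 k) :
    ∃ k' : c.T → c'.T, F.IsHolonomyMap γ'.1.extend c 0 c' 1 k' ∧ k =ᶠ[𝓝 (c.base x)] k' := by
  have hx := hk.left.2
  have hy := hk.right.2
  rw [Path.extend_zero] at hx
  rw [Path.extend_one] at hy
  have hm : (k : Filter.Germ (𝓝 (c.base x)) c'.T) ∈ F.holonomyGerms γ.1 c c' := ⟨k, hk, rfl⟩
  rw [h c hk.left.1 c' hk.right.1 hx hy] at hm
  obtain ⟨k', hk', e⟩ := hm
  exact ⟨k', hk', (Filter.Germ.coe_eq.1 e).symm⟩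

theorem holonomyGerms_trans_subset {x y z : Y} {γ₁ γ₂ : {γ : Path x y // F.IsLeafPath γ}}
    {δ₁ δ₂ : {γ : Path y z // F.IsLeafPath γ}} (h : (F.holonomySetoid x y).r γ₁ γ₂)
    (k : (F.holonomySetoid y z).r δ₁ δ₂) (c c' : LineChart Y) :
    F.holonomyGerms (γ₁.1.trans δ₁.1) c c' ⊆ F.holonomyGerms (γ₂.1.trans δ₂.1) c c' := by
  intro g hg
  rw [mem_holonomyGerms_trans] at hg ⊢
  obtain ⟨e, p, q, hp, hq, rfl⟩ := hg
  obtain ⟨p', hp', ep⟩ := exists_of_equiv h hp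
  obtain ⟨q', hq', eq⟩ := exists_of_equiv k hq
  refine ⟨e, p', q', hp', hq', Filter.Germ.coe_eq.2 ?_⟩
  have ht := hp.tendsto
  rw [Path.extend_zero, Path.extend_one] at ht
  filter_upwards [ep, ht.eventually eq] with w hw hw'
  simp only [Function.comp_apply]
  rw [hw', hw]

theorem holonomyGerms_symm_subset {x y : Y} {γ₁ γ₂ : {γ : Path x y // F.IsLeafPath γ}}
    (h : (F.holonomySetoid x y).r γ₁ γ₂) (c c' : LineChart Y) :
    F.holonomyGerms γ₁.1.symm c c' ⊆ F.holonomyGerms γ₂.1.symm c c' := by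
  rintro g ⟨p, hp, rfl⟩
  obtain ⟨q, hq, q1, q2⟩ := hp.reverse (g := γ₁.1.extend)
    (fun s => (γ₁.1.extend_symm_apply s).symm)
  rw [sub_self, sub_zero] at hq
  obtain ⟨q', hq', e⟩ := exists_of_equiv h hq
  obtain ⟨p', hp', r1, r2⟩ := hq'.reverse (g := γ₂.1.symm.extend)
    (fun s => by rw [γ₂.1.extend_symm_apply, sub_sub_cancel])
  rw [sub_self, sub_zero] at hp'
  refine ⟨p', hp', Filter.Germ.coe_eq.2 ?_⟩
  have ht := hp.tendsto
  rw [Path.extend_zero, Path.extend_one] at ht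
  rw [Path.extend_zero] at q1 r1
  filter_upwards [q1, ht.eventually e, ht.eventually r1] with w hw hw' hw''
  rw [← hw', hw] at hw''
  exact hw''

variable (F)

namespace HolonomyClass

variable {F}

/-- The class of the constant path. -/
def const (F : LineFoliation Y) (x : Y) : F.HolonomyClass x x :=
  F.holonomyClass (Path.refl x) (IsLeafPath.refl x)

/-- Concatenation of holonomy classes. -/
def comp {x y z : Y} : F.HolonomyClass x y → F.HolonomyClass y z → F.HolonomyClass x z :=
  Quotient.map₂ (fun γ δ => ⟨γ.1.trans δ.1, γ.2.trans δ.2⟩) fun _ _ h _ _ k c _ c' _ _ _ =>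
    (holonomyGerms_trans_subset h k c c').antisymm
      (holonomyGerms_trans_subset ((F.holonomySetoid x y).symm h)
        ((F.holonomySetoid y z).symm k) c c')

/-- Reversal of holonomy classes. -/
def reverse {x y : Y} : F.HolonomyClass x y → F.HolonomyClass y x :=
  Quotient.map (fun γ => ⟨γ.1.symm, γ.2.symm⟩) fun _ _ h c _ c' _ _ _ =>
    (holonomyGerms_symm_subset h c c').antisymm
      (holonomyGerms_symm_subset ((F.holonomySetoid x y).symm h) c c')

end HolonomyClass

/-! ### The holonomy groupoid -/

/-- The set of all holonomy classes of leaf paths. The class of `γ` has range `γ 0` and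
source `γ 1`. -/
structure HolonomyGroupoid where
  range : Y
  source : Y
  cls : F.HolonomyClass range source

/-- The groupoid operations: the units are the classes of constant paths, multiplication is
induced by concatenation and inversion by reversal. -/
def holonomyGroupoid : GroupoidData F.HolonomyGroupoid where
  d g := ⟨g.source, g.source, HolonomyClass.const F g.source⟩
  r g := ⟨g.range, g.range, HolonomyClass.const F g.range⟩
  mul g h e := ⟨g.range, h.source, g.cls.comp
    ((show g.source = h.range from congrArg HolonomyGroupoid.range e) ▸ h.cls)⟩
  inv g := ⟨g.source, g.range, g.cls.reverse⟩

/-- The path passes successively through the domains of the charts `U 0, …, U (n - 1)`. -/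
def FollowsChain {x y : Y} (γ : Path x y) {n : ℕ} (U : Fin n → LineChart Y) : Prop :=
  ∃ t : Fin (n + 1) → ℝ, StrictMono t ∧ t 0 = 0 ∧ t (Fin.last n) = 1 ∧
    ∀ i : Fin n, ∀ s ∈ Icc (t i.castSucc) (t i.succ), γ.extend s ∈ (U i).dom

/-- The set of the holonomy classes of all leaf paths that pass successively through the domains
of the charts `U 0, …, U (n - 1)`. -/
def chainSet {n : ℕ} (U : Fin n → LineChart Y) : Set F.HolonomyGroupoid :=
  {g | ∃ (γ : Path g.range g.source) (hγ : F.IsLeafPath γ),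
    FollowsChain γ U ∧ F.holonomyClass γ hγ = g.cls}

/-- The topology of the holonomy groupoid: the sets `chainSet U`, for all finite chains `U` of
charts of the foliation, are a subbase. -/
instance : TopologicalSpace F.HolonomyGroupoid :=
  TopologicalSpace.generateFrom
    {V | ∃ (n : ℕ) (U : Fin n → LineChart Y), (∀ i, U i ∈ F.charts) ∧ V = F.chainSet U}

end LineFoliation

/-! ### The foliation induced by a flow -/

/-- `(S, l)` is a tube of the flow: `S` is compact, `l > 0`, and `(y, t) ↦ α_t y` is an embedding
of `S × [-l/2, l/2]`. The tube itself is the image `B` of this map. -/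
def IsTube {Y : Type u} [TopologicalSpace Y] (α : Flow ℝ Y) (S : Set Y) (l : ℝ) : Prop :=
  IsCompact S ∧ 0 < l ∧ IsEmbedding fun p : S × Icc (-(l / 2)) (l / 2) => α p.2 (p.1 : Y)

/-- The tube as a subset of the space. -/
def tubeSet {Y : Type u} [TopologicalSpace Y] (α : Flow ℝ Y) (S : Set Y) (l : ℝ) : Set Y :=
  {z | ∃ y ∈ S, ∃ t ∈ Icc (-(l / 2)) (l / 2), α t y = z}

/-- The atlas of charts given by the open tubes `B°`. The domain of the chart is `B°`, the
transversal is the open central slice `S ∩ B°` (up to a homeomorphism `τ`), and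
`φ (α_t y) = (t, y)` for `y ∈ S ∩ B°` and `t ∈ (-l/2, l/2)`, where the interval `(-l/2, l/2)` is
identified with `ℝ` by an increasing bijection `θ`. -/
def openTubeCharts {Y : Type u} [TopologicalSpace Y] (α : Flow ℝ Y) : Set (LineChart Y) :=
  {c | ∃ (S : Set Y) (l : ℝ), IsTube α S l ∧ c.dom = interior (tubeSet α S l) ∧
    ∃ (θ : Ioo (-(l / 2)) (l / 2) ≃o ℝ) (τ : (S ∩ interior (tubeSet α S l) : Set Y) ≃ₜ c.T),
      ∀ (y : (S ∩ interior (tubeSet α S l) : Set Y)) (t : Ioo (-(l / 2)) (l / 2)),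
        α t (y : Y) ∈ c.dom ∧ c.φ (α t (y : Y)) = (θ t, τ y)}

/-- The path `s ↦ α_{-ts} y`, for `s ∈ [0, 1]`, from `y` to `α_{-t} y`. -/
def orbitPath {Y : Type u} [TopologicalSpace Y] (α : Flow ℝ Y) (y : Y) (t : ℝ) :
    Path y (α (-t) y) where
  toFun s := α (-(t * (s : ℝ))) y
  continuous_toFun := α.continuous (by fun_prop) continuous_const
  source' := by simp
  target' := by simp

end

/-! Near a point `y` with `α t₀ y ≠ y`, the average of `dist (α s z) y` over `s` from `0` to `t₀` is
strictly increasing along short orbit segments. Its level sets are therefore cross sections, and a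
compact piece of one gives a tube as small as desired (`exists_isTube`). Plaques of open tube charts
are orbit segments with a continuous time coordinate, so any two such charts are coherent and the
leaves are the orbits.

Every leaf path from `x` has the form `s ↦ α (-u s) x` with `u` continuous and `u 0 = 0`
(`exists_lift`): an orbit meets only countably many plaques of a chart, and a countable subset of a
metrizable transversal is totally disconnected, so the path stays locally on one plaque. The
holonomy of such a path is the germ induced by `α (-u 1)` (`holonomyMap_eventuallyEq`), so only the
total time `u 1` matters. Hence `π` is surjective. Two times give the same class at `x` exactly when
their difference `p` is a local period: each `q` near `x` is fixed by `α (p + ε)` for some small `ε`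
depending on `q` (`orbitArrow_eq_iff`).

Nontrivial small periods do not occur near a point, so `π` is locally injective. It is continuous
because local periods persist at nearby points after a small correction
(`eventually_isLocalPeriod`), and the correction can be absorbed into the time function of a curve
following a chain. It is open because some chain of charts determines the starting point and the
total time up to a prescribed error (`hasChain`). Finally, the topological groupoid axioms pass from
`Y ⋊ ℝ` to the holonomy groupoid along the open continuous surjection `π`. -/

namespace Flow

variable {Y : Type u} [TopologicalSpace Y] (α : Flow ℝ Y)

/-! ### Elementary facts about flows -/

theorem apply_apply (s t : ℝ) (y : Y) : α s (α t y) = α (s + t) y := (α.map_add s t y).symm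

theorem eq_neg_of_eq {t : ℝ} {y z : Y} (h : z = α t y) : y = α (-t) z := by
  rw [h, α.apply_apply, neg_add_cancel, α.map_zero_apply]

theorem tendsto_nhds (t : ℝ) (y : Y) : Tendsto (α t) (𝓝 y) (𝓝 (α t y)) :=
  (α.continuous_toFun t).continuousAt

theorem map_nhds (t : ℝ) (y : Y) : map (α t) (𝓝 y) = 𝓝 (α t y) :=
  (α.toHomeomorph t).map_nhds_eq y

theorem tendsto_orbit (y : Y) : Tendsto (fun t : ℝ => α t y) (𝓝 0) (𝓝 y) := by
  have : Continuous fun t : ℝ => α t y := α.continuous continuous_id continuous_const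
  simpa using this.tendsto 0

theorem tendsto_uncurry (y : Y) : Tendsto (fun p : ℝ × Y => α p.1 p.2) (𝓝 0 ×ˢ 𝓝 y) (𝓝 y) := by
  have : Continuous fun p : ℝ × Y => α p.1 p.2 := α.continuous continuous_fst continuous_snd
  simpa [nhds_prod_eq] using this.tendsto (0, y)

/-- Joint continuity at `(0, p)`. It provides one time scale for all points near `p`, which
pointwise continuity of orbits would not. -/
theorem eventually_forall_mem {p : Y} {W : Set Y} (hW : W ∈ 𝓝 p) :
    ∃ δ > 0, ∀ᶠ q in 𝓝 p, ∀ v : ℝ, |v| < δ → α v q ∈ W := by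
  obtain ⟨P, hP, Q, hQ, hPQ⟩ := eventually_prod_iff.1 ((α.tendsto_uncurry p).eventually hW)
  obtain ⟨δ, hδ, hd⟩ := Metric.eventually_nhds_iff.1 hP
  exact ⟨δ, hδ, hQ.mono fun q hq v hv => hPQ (hd (by simpa using hv)) hq⟩

end Flow

/-! ### Coordinates in a tube -/

section Tubes

variable {Y : Type u} [TopologicalSpace Y] {α : Flow ℝ Y} {S : Set Y} {l : ℝ}

theorem IsTube.injective (h : IsTube α S l) {y y' : Y} (hy : y ∈ S) (hy' : y' ∈ S) {t t' : ℝ}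
    (ht : t ∈ Icc (-(l / 2)) (l / 2)) (ht' : t' ∈ Icc (-(l / 2)) (l / 2))
    (e : α t y = α t' y') : y = y' ∧ t = t' := by
  have := h.2.2.injective (a₁ := (⟨y, hy⟩, ⟨t, ht⟩)) (a₂ := (⟨y', hy'⟩, ⟨t', ht'⟩)) e
  simpa using this

/-- Near an interior point of a tube, the tube coordinates are close to those of the point. -/
theorem IsTube.eventually (h : IsTube α S l) {y : Y} {s : ℝ} (hy : y ∈ S)
    (hs : s ∈ Icc (-(l / 2)) (l / 2)) (hz : α s y ∈ interior (tubeSet α S l)) {O : Set ℝ}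
    (hO : O ∈ 𝓝 s) :
    ∀ᶠ w in 𝓝 (α s y), ∃ y' ∈ S, ∃ s' ∈ Icc (-(l / 2)) (l / 2), s' ∈ O ∧ w = α s' y' := by
  have hr : range (fun p : S × Icc (-(l / 2)) (l / 2) => α p.2 (p.1 : Y)) = tubeSet α S l := by
    ext z
    simp [tubeSet]
  have hm := h.2.2.map_nhds_of_mem (⟨y, hy⟩, ⟨s, hs⟩)
    (by rw [hr]; exact mem_interior_iff_mem_nhds.1 hz)
  dsimp only at hm
  rw [← hm, eventually_map]
  have ht : Tendsto (fun p : S × Icc (-(l / 2)) (l / 2) => (p.2 : ℝ))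
      (𝓝 (⟨y, hy⟩, ⟨s, hs⟩)) (𝓝 s) :=
    (continuous_subtype_val.comp continuous_snd).tendsto _
  filter_upwards [ht hO] with p hp
  exact ⟨p.1, p.1.2, p.2, p.2.2, hp, rfl⟩

/-- If `s` were an endpoint, flowing outward for a short time `ε` would stay in the tube, at a point
with time coordinate `s'` close to `s`. Flowing back gives a second pair of coordinates for `α s y`,
and injectivity puts `s'` beyond the endpoint. -/
theorem IsTube.mem_Ioo (h : IsTube α S l) {y : Y} {s : ℝ} (hy : y ∈ S)
    (hs : s ∈ Icc (-(l / 2)) (l / 2)) (hz : α s y ∈ interior (tubeSet α S l)) :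
    s ∈ Ioo (-(l / 2)) (l / 2) := by
  have hl := h.2.1
  have hev := (α.tendsto_orbit (α s y)).eventually
    (h.eventually hy hs hz (Metric.ball_mem_nhds s (half_pos hl)))
  obtain ⟨δ, hδ, hd⟩ := Metric.eventually_nhds_iff.1 hev
  -- The bound `l / 2`, together with `|s' - s| < l / 2`, keeps the time obtained by flowing back
  -- inside the interval on which the tube map is injective.
  set ε := min (δ / 2) (l / 2)
  have h0 : 0 < ε := lt_min (half_pos hδ) (half_pos hl)
  have h1 : ε ≤ l / 2 := min_le_right _ _
  have h2 : ε < δ := (min_le_left _ _).trans_lt (half_lt_self hδ)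
  constructor
  · refine lt_of_le_of_ne hs.1 fun e => ?_
    obtain ⟨y', hy', s', hs', hb, e'⟩ := hd (y := -ε) (by simpa [abs_of_pos h0] using h2)
    rw [Metric.mem_ball, Real.dist_eq, abs_lt] at hb
    have e2 := α.eq_neg_of_eq e'.symm
    rw [neg_neg, α.apply_apply] at e2
    have := (h.injective hy hy' hs ⟨by linarith [hs'.1], by linarith⟩ e2).2
    linarith [hs'.1]
  · refine lt_of_le_of_ne hs.2 fun e => ?_
    obtain ⟨y', hy', s', hs', hb, e'⟩ := hd (y := ε) (by simpa [abs_of_pos h0] using h2)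
    rw [Metric.mem_ball, Real.dist_eq, abs_lt] at hb
    have e2 := α.eq_neg_of_eq e'.symm
    rw [α.apply_apply] at e2
    have := (h.injective hy hy' hs ⟨by linarith, by linarith [hs'.2]⟩ e2).2
    linarith [hs'.2]

/-- Translation by `α (t - s)` carries a neighbourhood of `α s y` to one of `α t y`, and the shifted
time coordinates stay in the interval. Thus the interior of a tube is a product of its central slice
with the open interval. -/
theorem IsTube.mem_interior (h : IsTube α S l) {y : Y} {s t : ℝ} (hy : y ∈ S)
    (hs : s ∈ Icc (-(l / 2)) (l / 2)) (hz : α s y ∈ interior (tubeSet α S l))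
    (ht : t ∈ Ioo (-(l / 2)) (l / 2)) : α t y ∈ interior (tubeSet α S l) := by
  have hev := h.eventually hy hs hz (O := (fun r => r + (t - s)) ⁻¹' Ioo (-(l / 2)) (l / 2)) <|
    (continuous_add_const (t - s)).continuousAt.preimage_mem_nhds
      (by rw [add_sub_cancel]; exact isOpen_Ioo.mem_nhds ht)
  have e : α t y = α (t - s) (α s y) := by rw [α.apply_apply, sub_add_cancel]
  rw [mem_interior_iff_mem_nhds, e, ← α.map_nhds, mem_map]
  filter_upwards [hev] with w hw
  obtain ⟨y', hy', s', -, hs', rfl⟩ := hw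
  refine ⟨y', hy', s' + (t - s), Ioo_subset_Icc_self hs', ?_⟩
  rw [α.apply_apply, add_comm]

theorem IsTube.exists_of_mem_interior (h : IsTube α S l) {z : Y}
    (hz : z ∈ interior (tubeSet α S l)) :
    ∃ y ∈ S ∩ interior (tubeSet α S l), ∃ t ∈ Ioo (-(l / 2)) (l / 2), α t y = z := by
  obtain ⟨y, hy, t, ht, rfl⟩ := interior_subset hz
  refine ⟨y, ⟨hy, ?_⟩, t, h.mem_Ioo hy ht hz, rfl⟩
  have := h.mem_interior hy ht hz (t := 0) ⟨by linarith [h.2.1], by linarith [h.2.1]⟩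
  rwa [α.map_zero_apply] at this

end Tubes

/-! ### Existence of small tubes -/

section TubeExistence

variable {Y : Type u} [TopologicalSpace Y]

/-- A point which is not fixed by the flow has a neighbourhood and a continuous function that is
strictly monotone along the short orbit segments starting in the neighbourhood. -/
theorem exists_strictMonoOn_orbit [TopologicalSpace.MetrizableSpace Y] (α : Flow ℝ Y) {y : Y}
    {t₀ : ℝ} (h : α t₀ y ≠ y) :
    ∃ g : Y → ℝ, Continuous g ∧ ∃ ε > 0, ∀ᶠ z in 𝓝 y,
      StrictMonoOn (fun t => g (α t z)) (Icc (-ε) ε) := by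
  let _ := TopologicalSpace.metrizableSpaceMetric Y
  have hc : ∀ z, Continuous fun s : ℝ => dist (α s z) y := fun z =>
    (α.continuous continuous_id continuous_const).dist continuous_const
  -- Along the orbit of `z` this function has derivative `dist (α (r + t₀) z) y - dist (α r z) y` at
  -- time `r`, which is positive near `r = 0`, `z = y`. The oriented integral covers both signs of
  -- `t₀`.
  refine ⟨fun z => ∫ s in (0 : ℝ)..t₀, dist (α s z) y, ?_, ?_⟩
  · refine intervalIntegral.continuous_parametric_intervalIntegral_of_continuous'
      (f := fun z s => dist (α s z) y) ?_ 0 t₀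
    exact (α.continuous continuous_snd continuous_fst).dist continuous_const
  have hpos : ∀ᶠ p : ℝ × Y in 𝓝 0 ×ˢ 𝓝 y, dist (α p.1 p.2) y < dist (α (p.1 + t₀) p.2) y := by
    have c1 : Continuous fun p : ℝ × Y => dist (α p.1 p.2) y :=
      (α.continuous continuous_fst continuous_snd).dist continuous_const
    have c2 : Continuous fun p : ℝ × Y => dist (α (p.1 + t₀) p.2) y :=
      (α.continuous (continuous_fst.add continuous_const) continuous_snd).dist continuous_const
    rw [← nhds_prod_eq]
    refine c1.continuousAt.eventually_lt c2.continuousAt ?_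
    simpa using h
  obtain ⟨P, hP, Q, hQ, hPQ⟩ := eventually_prod_iff.1 hpos
  obtain ⟨δ, hδ, hd⟩ := Metric.eventually_nhds_iff.1 hP
  refine ⟨δ / 2, half_pos hδ, hQ.mono fun z hz => ?_⟩
  intro a ha b hb hab
  have shift : ∀ r, ∫ s in (0 : ℝ)..t₀, dist (α s (α r z)) y =
      ∫ s in r..(r + t₀), dist (α s z) y := fun r => by
    have := intervalIntegral.integral_comp_add_right (a := 0) (b := t₀)
      (fun s => dist (α s z) y) r
    rw [zero_add, add_comm t₀] at this
    rw [← this]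
    simp only [α.apply_apply]
  dsimp only
  rw [shift, shift, ← sub_pos]
  have hi : ∀ p q, IntervalIntegrable (fun s => dist (α s z) y) MeasureTheory.volume p q :=
    fun p q => (hc z).intervalIntegrable p q
  have hi' : IntervalIntegrable (fun s => dist (α (s + t₀) z) y) MeasureTheory.volume a b :=
    ((hc z).comp (continuous_add_const t₀)).intervalIntegrable _ _
  -- The increment as the integral of the expected derivative, obtained by rearranging intervals
  -- without differentiating.
  have e : (∫ s in b..(b + t₀), dist (α s z) y) - ∫ s in a..(a + t₀), dist (α s z) y =
      ∫ s in a..b, (dist (α (s + t₀) z) y - dist (α s z) y) := by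
    rw [intervalIntegral.integral_sub hi' (hi _ _),
      intervalIntegral.integral_comp_add_right (fun s => dist (α s z) y) t₀]
    have h1 := intervalIntegral.integral_add_adjacent_intervals (hi a b) (hi b (b + t₀))
    have h2 := intervalIntegral.integral_add_adjacent_intervals (hi a (a + t₀))
      (hi (a + t₀) (b + t₀))
    linarith
  rw [e]
  refine intervalIntegral.intervalIntegral_pos_of_pos_on
    (hi'.sub (hi a b)) ?_ hab
  intro s hs
  refine sub_pos.2 (hPQ (hd ?_) hz)
  rw [Real.dist_eq, sub_zero, abs_lt]
  constructor <;> linarith [hs.1, hs.2, ha.1, hb.2]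

/-- The slice is a level set of the monotone function inside a compact neighbourhood. Monotonicity
gives injectivity of the flow map, compactness makes it an embedding, and the intermediate value
theorem shows that nearby orbits hit the slice. -/
theorem exists_isTube [LocallyCompactSpace Y] [TopologicalSpace.MetrizableSpace Y]
    (α : Flow ℝ Y) {y : Y} {t₀ : ℝ} (h : α t₀ y ≠ y) {W : Set Y} (hW : W ∈ 𝓝 y) :
    ∃ (S : Set Y) (l : ℝ), IsTube α S l ∧ y ∈ S ∧ y ∈ interior (tubeSet α S l) ∧
      tubeSet α S l ⊆ W := by
  obtain ⟨g, hg, ε, hε, hmono⟩ := exists_strictMonoOn_orbit α h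
  obtain ⟨δ₁, hδ₁, hd₁⟩ := α.eventually_forall_mem hW
  obtain ⟨K, hK, hKm, hKc⟩ := local_compact_nhds (hmono.and hd₁)
  obtain ⟨δ₂, hδ₂, hd₂⟩ := α.eventually_forall_mem hK
  -- `ε` controls differences of two times in `[-l/2, l/2]`, `δ₁` keeps the tube in `W`, and `δ₂`
  -- keeps the hitting point of a nearby orbit in `K`.
  set l := min ε (min δ₁ δ₂)
  have h0 : 0 < l := lt_min hε (lt_min hδ₁ hδ₂)
  have h1 : l ≤ ε := min_le_left _ _
  have h2 : l ≤ δ₁ := (min_le_right _ _).trans (min_le_left _ _)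
  have h3 : l ≤ δ₂ := (min_le_right _ _).trans (min_le_right _ _)
  have hS : IsCompact (K ∩ {z | g z = g y}) :=
    hKc.inter_right (isClosed_eq hg continuous_const)
  refine ⟨K ∩ {z | g z = g y}, l, ⟨hS, h0, ?_⟩, ⟨mem_of_mem_nhds hK, rfl⟩, ?_, ?_⟩
  · have := isCompact_iff_compactSpace.1 hS
    refine (Continuous.isClosedEmbedding ?_ ?_).isEmbedding
    · exact α.continuous (continuous_subtype_val.comp continuous_snd)
        (continuous_subtype_val.comp continuous_fst)
    · rintro ⟨⟨z, hz, hz'⟩, ⟨t, ht⟩⟩ ⟨⟨w, hw, hw'⟩, ⟨s, hs⟩⟩ e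
      dsimp only at e
      have e' : w = α (t - s) z := by
        rw [α.eq_neg_of_eq e, α.apply_apply]
        congr 1
        ring
      have hm : (0 : ℝ) ∈ Icc (-ε) ε := ⟨by linarith, hε.le⟩
      have hm' : t - s ∈ Icc (-ε) ε :=
        ⟨by linarith [ht.1, hs.2], by linarith [ht.2, hs.1]⟩
      have hts : t - s = 0 := by
        refine (hKm hz).1.injOn hm' hm ?_
        rw [← e', α.map_zero_apply]
        exact Eq.trans hw' hz'.symm
      obtain rfl : t = s := sub_eq_zero.1 hts
      rw [sub_self, α.map_zero_apply] at e'
      subst e'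
      rfl
  · have hm : ∀ r ∈ Icc (-(l / 2)) (l / 2), r ∈ Icc (-ε) ε := fun r hr =>
      ⟨by linarith [hr.1], by linarith [hr.2]⟩
    have hl1 : -(l / 2) ∈ Icc (-(l / 2)) (l / 2) := ⟨le_rfl, by linarith⟩
    have hl2 : l / 2 ∈ Icc (-(l / 2)) (l / 2) := ⟨by linarith, le_rfl⟩
    have hl0 : (0 : ℝ) ∈ Icc (-(l / 2)) (l / 2) := ⟨by linarith, by linarith⟩
    have hy := (hKm (mem_of_mem_nhds hK)).1
    have k1 : g (α (-(l / 2)) y) < g y := by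
      have := hy (hm _ hl1) (hm _ hl0) (by linarith)
      simpa using this
    have k2 : g y < g (α (l / 2) y) := by
      have := hy (hm _ hl0) (hm _ hl2) (by linarith)
      simpa using this
    have n1 : ∀ᶠ z in 𝓝 y, g (α (-(l / 2)) z) < g y :=
      (hg.comp (α.continuous_toFun _)).continuousAt.eventually_lt continuousAt_const k1
    have n2 : ∀ᶠ z in 𝓝 y, g y < g (α (l / 2) z) :=
      continuousAt_const.eventually_lt (hg.comp (α.continuous_toFun _)).continuousAt k2
    rw [mem_interior_iff_mem_nhds]
    filter_upwards [n1, n2, hd₂] with z z1 z2 zQ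
    have hcont : ContinuousOn (fun t => g (α t z)) (Icc (-(l / 2)) (l / 2)) :=
      (hg.comp (α.continuous continuous_id continuous_const)).continuousOn
    obtain ⟨t, ht, e⟩ := intermediate_value_Icc (by linarith) hcont ⟨z1.le, z2.le⟩
    refine ⟨α t z, ⟨zQ t ?_, e⟩, -t, ⟨by linarith [ht.2], by linarith [ht.1]⟩, ?_⟩
    · rw [abs_lt]
      constructor <;> linarith [ht.1, ht.2]
    · rw [α.apply_apply, neg_add_cancel, α.map_zero_apply]
  · rintro _ ⟨z, hz, t, ht, rfl⟩
    refine (hKm hz.1).2 t ?_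
    rw [abs_lt]
    constructor <;> linarith [ht.1, ht.2]

end TubeExistence

/-- A function which is locally constant near every point of a connected set is constant on it. -/
theorem IsPreconnected.eq_of_eventually_eq {X Z : Type*} [TopologicalSpace X] {s : Set X}
    (hs : IsPreconnected s) {g : X → Z} (hg : ∀ v ∈ s, ∀ᶠ w in 𝓝[s] v, g w = g v) {a b : X}
    (ha : a ∈ s) (hb : b ∈ s) : g a = g b := by
  let _ : TopologicalSpace Z := ⊥
  have : DiscreteTopology Z := ⟨rfl⟩
  refine hs.constant (f := g) (fun v hv => ?_) ha hb
  rw [ContinuousWithinAt, nhds_discrete, tendsto_pure]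
  exact hg v hv

/-! ### Flow boxes and the foliated atlas -/

section FlowBox

variable {Y : Type u} [TopologicalSpace Y]

/-- The chart `c` is a flow box with time coordinate `τ`: the points of each plaque are on one
orbit, and `τ` is the time along it. -/
structure LineChart.IsFlowBox (α : Flow ℝ Y) (c : LineChart Y) (τ : Y → ℝ) : Prop where
  continuousOn : ContinuousOn τ c.dom
  eq_flow : ∀ p ∈ c.dom, ∀ q ∈ c.dom, c.base p = c.base q → q = α (τ q - τ p) p
  eventually : ∀ p ∈ c.dom, ∀ᶠ t in 𝓝 (0 : ℝ),
    α t p ∈ c.dom ∧ c.base (α t p) = c.base p ∧ τ (α t p) = τ p + t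

theorem LineChart.isOpen_dom (c : LineChart Y) : IsOpen c.dom := c.φ.open_source

theorem LineChart.dom_mem_nhds {c : LineChart Y} {p : Y} (hp : p ∈ c.dom) : c.dom ∈ 𝓝 p :=
  c.isOpen_dom.mem_nhds hp

theorem LineChart.continuousAt_base {c : LineChart Y} {p : Y} (hp : p ∈ c.dom) :
    ContinuousAt c.base p :=
  continuous_snd.continuousAt.comp (c.φ.continuousAt hp)

variable {α : Flow ℝ Y}

/-- A point `q` near `p` on the plaque of `c` is reached from `p` in the short time `τ q - τ p`, and
short flow times do not leave the plaque of `c'`. -/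
theorem LineChart.IsFlowBox.mem_nhdsWithin {c c' : LineChart Y} {τ τ' : Y → ℝ}
    (h : c.IsFlowBox α τ) (h' : c'.IsFlowBox α τ') {p : Y} (hp : p ∈ c.dom) (hp' : p ∈ c'.dom) :
    c'.plaque (c'.base p) ∈ 𝓝[c.plaque (c.base p)] p := by
  have ht : Tendsto (fun q => τ q - τ p) (𝓝[c.plaque (c.base p)] p) (𝓝 0) := by
    have : ContinuousAt τ p := h.continuousOn.continuousAt (LineChart.dom_mem_nhds hp)
    have := (Filter.Tendsto.sub_const this (τ p)).mono_left
      (nhdsWithin_le_nhds (s := c.plaque (c.base p)))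
    rwa [sub_self] at this
  filter_upwards [ht.eventually (h'.eventually p hp'), self_mem_nhdsWithin] with q hq hqc
  have e := h.eq_flow p hp q hqc.1 hqc.2.symm
  rw [← e] at hq
  exact ⟨hq.1, hq.2.1⟩

theorem LineChart.IsFlowBox.coherent {c c' : LineChart Y} {τ τ' : Y → ℝ}
    (h : c.IsFlowBox α τ) (h' : c'.IsFlowBox α τ') : c.Coherent c' :=
  LineChart.coherent_of_mem (fun _ hp hp' => h.mem_nhdsWithin h' hp hp')
    (fun _ hp hp' => h'.mem_nhdsWithin h hp' hp)

theorem exists_isFlowBox_of_mem_openTubeCharts {c : LineChart Y} (hc : c ∈ openTubeCharts α) :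
    ∃ τ, c.IsFlowBox α τ := by
  obtain ⟨S, l, hS, hdom, θ, σ, hφ⟩ := hc
  have hcoord : ∀ z ∈ c.dom, ∃ (y : (S ∩ interior (tubeSet α S l) : Set Y))
      (t : Ioo (-(l / 2)) (l / 2)), α t (y : Y) = z := fun z hz => by
    obtain ⟨y, hy, t, ht, e⟩ := hS.exists_of_mem_interior (hdom ▸ hz)
    exact ⟨⟨y, hy⟩, ⟨t, ht⟩, e⟩
  have hτ : ∀ y t, ((θ.symm (c.φ (α ((t : Ioo (-(l / 2)) (l / 2)) : ℝ)
      ((y : (S ∩ interior (tubeSet α S l) : Set Y)) : Y))).1 : Ioo (-(l / 2)) (l / 2)) : ℝ) = t :=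
    fun y t => by rw [(hφ y t).2, θ.symm_apply_apply]
  have hb : ∀ y t, c.base (α ((t : Ioo (-(l / 2)) (l / 2)) : ℝ)
      ((y : (S ∩ interior (tubeSet α S l) : Set Y)) : Y)) = σ y := fun y t => by
    unfold LineChart.base
    rw [(hφ y t).2]
  refine ⟨fun z => θ.symm (c.φ z).1, ?_, ?_, ?_⟩
  · exact continuous_subtype_val.comp_continuousOn (θ.toHomeomorph.symm.continuous.comp_continuousOn
      (continuous_fst.comp_continuousOn c.φ.continuousOn))
  · intro p hp q hq e
    obtain ⟨y, t, rfl⟩ := hcoord p hp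
    obtain ⟨y', t', rfl⟩ := hcoord q hq
    rw [hb, hb] at e
    obtain rfl := σ.injective e
    rw [hτ, hτ, α.apply_apply, sub_add_cancel]
  · intro p hp
    obtain ⟨y, t, rfl⟩ := hcoord p hp
    have hm : ∀ᶠ r in 𝓝 (0 : ℝ), (t : ℝ) + r ∈ Ioo (-(l / 2)) (l / 2) :=
      (continuous_const_add (t : ℝ)).continuousAt.eventually
        (by beta_reduce; rw [add_zero]; exact isOpen_Ioo.mem_nhds t.2)
    filter_upwards [hm] with r hr
    rw [α.apply_apply, add_comm]
    have h1 := hφ y ⟨_, hr⟩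
    have h2 := hb y ⟨_, hr⟩
    have h3 := hτ y ⟨_, hr⟩
    dsimp only at h1 h2 h3 ⊢
    refine ⟨h1.1, ?_, ?_⟩
    · rw [h2, hb]
    · rw [h3, hτ]

/-- An increasing bijection between a bounded open interval and the line. -/
theorem exists_orderIso_Ioo {a : ℝ} (ha : 0 < a) : Nonempty (Ioo (-a) a ≃o ℝ) := by
  refine ⟨OrderIso.trans (β := Ioo (-1 : ℝ) 1) ⟨⟨fun t => ⟨t / a, ?_, ?_⟩,
    fun t => ⟨t * a, ?_, ?_⟩, fun t => ?_, fun t => ?_⟩, fun {s t} => ?_⟩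
    (orderIsoIooNegOneOne ℝ).symm⟩
  · rw [lt_div_iff₀ ha]; linarith [t.2.1]
  · rw [div_lt_iff₀ ha]; linarith [t.2.2]
  · nlinarith [t.2.1]
  · nlinarith [t.2.2]
  · ext; exact div_mul_cancel₀ _ ha.ne'
  · ext; exact mul_div_cancel_right₀ _ ha.ne'
  · rw [← Subtype.coe_le_coe, ← Subtype.coe_le_coe]
    exact div_le_div_iff_of_pos_right ha

/-- The tube embedding, restricted to the open slice and the open interval, has the interior of the
tube as image and is an open embedding; its inverse is the chart. Smallness of the domain is what
openness of `π` will need. -/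
theorem exists_mem_openTubeCharts [LocallyCompactSpace Y] [TopologicalSpace.MetrizableSpace Y]
    (hα : ∀ y : Y, ∃ t : ℝ, α t y ≠ y) (y₀ : Y) {W : Set Y}
    (hW : W ∈ 𝓝 y₀) : ∃ c ∈ openTubeCharts α, y₀ ∈ c.dom ∧ c.dom ⊆ W := by
  obtain ⟨t₀, ht₀⟩ := hα y₀
  obtain ⟨S, l, hS, hyS, hy, hSW⟩ := exists_isTube α ht₀ hW
  obtain ⟨θ⟩ := exists_orderIso_Ioo (half_pos hS.2.1)
  let T := (S ∩ interior (tubeSet α S l) : Set Y)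
  have hTl : LocallyCompactSpace T :=
    (hS.1.isClosed.isLocallyClosed.inter isOpen_interior.isLocallyClosed).locallyCompactSpace
  have hne : Nonempty T := ⟨⟨y₀, hyS, hy⟩⟩
  let f : ℝ × T → Y := fun p => α (θ.symm p.1 : ℝ) (p.2 : Y)
  have hI : ∀ (y : T) (t : Ioo (-(l / 2)) (l / 2)), α t (y : Y) ∈ interior (tubeSet α S l) :=
    fun y t => hS.mem_interior (s := 0) y.2.1 ⟨by linarith [hS.2.1], by linarith [hS.2.1]⟩
      (by rw [α.map_zero_apply]; exact y.2.2) t.2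
  have hr : range f = interior (tubeSet α S l) := by
    apply Subset.antisymm
    · rintro _ ⟨p, rfl⟩
      exact hI p.2 (θ.symm p.1)
    · intro z hz
      obtain ⟨y, hy, t, ht, rfl⟩ := hS.exists_of_mem_interior hz
      exact ⟨(θ ⟨t, ht⟩, ⟨y, hy⟩), by simp [f]⟩
  have hf : IsOpenEmbedding f := by
    refine ⟨?_, hr ▸ isOpen_interior⟩
    have e1 : IsEmbedding (inclusion (inter_subset_left : T ⊆ S)) := IsEmbedding.inclusion _
    have e2 : IsEmbedding (inclusion (Ioo_subset_Icc_self : Ioo (-(l / 2)) (l / 2) ⊆ _)) :=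
      IsEmbedding.inclusion _
    exact hS.2.2.comp ((e1.prodMap (e2.comp θ.symm.toHomeomorph.isEmbedding)).comp
      (Homeomorph.prodComm ℝ T).isEmbedding)
  let φ := (hf.toOpenPartialHomeomorph f).symm
  let c : LineChart Y := ⟨T, φ, by simp [φ]⟩
  have hdom : c.dom = interior (tubeSet α S l) := by
    rw [← hr]
    simp [c, φ, LineChart.dom]
  refine ⟨c, ⟨S, l, hS, hdom, θ, Homeomorph.refl _, fun y t =>
    ⟨hdom.symm ▸ hI y t, ?_⟩⟩, hdom.symm ▸ hy,
    hdom ▸ interior_subset.trans hSW⟩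
  have e : α t (y : Y) = f (θ t, y) := by simp [f]
  rw [e]
  exact (hf.toOpenPartialHomeomorph f).left_inv (by simp)

theorem isFoliatedAtlas_openTubeCharts [LocallyCompactSpace Y]
    [TopologicalSpace.MetrizableSpace Y] (hα : ∀ y : Y, ∃ t : ℝ, α t y ≠ y) :
    IsFoliatedAtlas (openTubeCharts α) where
  covers y := by
    obtain ⟨c, hc, hy, -⟩ := exists_mem_openTubeCharts hα y univ_mem
    exact ⟨c, hc, hy⟩
  coherent c hc c' hc' := by
    obtain ⟨τ, hτ⟩ := exists_isFlowBox_of_mem_openTubeCharts hc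
    obtain ⟨τ', hτ'⟩ := exists_isFlowBox_of_mem_openTubeCharts hc'
    exact hτ.coherent hτ'

end FlowBox

/-! ### Plaques and leaves in terms of the flow -/

namespace LineFoliation

variable {Y : Type u} [TopologicalSpace Y] {F : LineFoliation Y} {α : Flow ℝ Y}

/-- The foliation has enough flow boxes of the flow `α` among its charts. -/
def IsInducedBy (F : LineFoliation Y) (α : Flow ℝ Y) : Prop :=
  ∀ y, ∃ c ∈ F.charts, y ∈ c.dom ∧ ∃ τ, c.IsFlowBox α τ

namespace IsInducedBy

/-- Coherence with a flow box at `p` transfers this property of flow boxes to every chart of the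
foliation. -/
theorem eventually_base_orbit (hF : F.IsInducedBy α) {c : LineChart Y} (hc : c ∈ F.charts) {p : Y}
    (hp : p ∈ c.dom) :
    ∀ᶠ t in 𝓝 (0 : ℝ), α t p ∈ c.dom ∧ c.base (α t p) = c.base p := by
  obtain ⟨a, ha, hpa, τ, hτ⟩ := hF p
  have hm := mem_nhdsWithin_iff_eventually.1 ((F.isFoliatedAtlas.coherent a ha c hc).mem hpa hp)
  filter_upwards [hτ.eventually p hpa, (α.tendsto_orbit p).eventually hm] with t h1 h2
  exact h2 ⟨h1.1, h1.2.1⟩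

theorem eventually_nhds_orbit {P : Y → Prop} {z : Y} {v : ℝ}
    (h : ∀ᶠ t in 𝓝 (0 : ℝ), P (α t (α v z))) : ∀ᶠ w in 𝓝 v, P (α w z) := by
  have ht : Tendsto (fun w => w - v) (𝓝 v) (𝓝 0) := by
    simpa using (continuous_sub_right v).tendsto v
  filter_upwards [ht.eventually h] with w hw
  rwa [α.apply_apply, sub_add_cancel] at hw

theorem base_orbit_eq (hF : F.IsInducedBy α) {c : LineChart Y} (hc : c ∈ F.charts) {z : Y}
    {s : Set ℝ} (hs : IsPreconnected s) (h : ∀ v ∈ s, α v z ∈ c.dom) {a b : ℝ} (ha : a ∈ s)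
    (hb : b ∈ s) : c.base (α a z) = c.base (α b z) := by
  refine hs.eq_of_eventually_eq (g := fun v => c.base (α v z)) (fun v hv => ?_) ha hb
  have h1 := hF.eventually_base_orbit hc (h v hv)
  exact nhdsWithin_le_nhds (eventually_nhds_orbit (α := α)
    (P := fun q => c.base q = c.base (α v z)) (h1.mono fun _ ht => ht.2))

end IsInducedBy

theorem _root_.LineChart.IsFlowBox.time_orbit_eq {c : LineChart Y} {τ : Y → ℝ}
    (hc : c.IsFlowBox α τ) {z : Y}
    {s : Set ℝ} (hs : IsPreconnected s) (h : ∀ v ∈ s, α v z ∈ c.dom) {a b : ℝ} (ha : a ∈ s)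
    (hb : b ∈ s) : τ (α a z) - a = τ (α b z) - b := by
  refine hs.eq_of_eventually_eq (g := fun v => τ (α v z) - v) (fun v hv => ?_) ha hb
  refine nhdsWithin_le_nhds ?_
  have ht : Tendsto (fun w => w - v) (𝓝 v) (𝓝 0) := by
    simpa using (continuous_sub_right v).tendsto v
  filter_upwards [ht.eventually (hc.eventually _ (h v hv))] with w hw
  have := hw.2.2
  rw [α.apply_apply, sub_add_cancel] at this
  rw [this]
  ring

theorem isPreconnected_abs_lt (δ : ℝ) : IsPreconnected {v : ℝ | |v| < δ} := by
  have : {v : ℝ | |v| < δ} = Ioo (-δ) δ := by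
    ext v
    simp [abs_lt]
  rw [this]
  exact isPreconnected_Ioo

namespace IsInducedBy

theorem exists_base_flow_eq (hF : F.IsInducedBy α) {c : LineChart Y} (hc : c ∈ F.charts) {p : Y}
    (hp : p ∈ c.dom) :
    ∃ δ > 0, ∀ᶠ q in 𝓝 p, ∀ v : ℝ, |v| < δ → α v q ∈ c.dom ∧ c.base (α v q) = c.base q := by
  obtain ⟨δ, hδ, h⟩ := α.eventually_forall_mem (LineChart.dom_mem_nhds hp)
  refine ⟨δ, hδ, h.mono fun q hq v hv => ⟨hq v hv, ?_⟩⟩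
  have := hF.base_orbit_eq hc (isPreconnected_abs_lt δ) hq hv (b := 0) (by simpa using hδ)
  rwa [α.map_zero_apply] at this

/-- The time coordinate of a flow box advances at unit speed, so an orbit cannot return while it
remains in the box. This uniform absence of short periods gives local injectivity of `π`. -/
theorem exists_forall_flow_ne (hF : F.IsInducedBy α) (p : Y) :
    ∃ δ > 0, ∀ᶠ q in 𝓝 p, ∀ v : ℝ, |v| < δ → α v q = q → v = 0 := by
  obtain ⟨c, hc, hp, τ, hτ⟩ := hF p
  obtain ⟨δ, hδ, h⟩ := α.eventually_forall_mem (LineChart.dom_mem_nhds hp)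
  refine ⟨δ, hδ, h.mono fun q hq v hv e => ?_⟩
  have := hτ.time_orbit_eq (isPreconnected_abs_lt δ) hq hv (b := 0) (by simpa using hδ)
  rw [α.map_zero_apply, e] at this
  linarith

theorem _root_.LineFoliation.eventually_base_symm {c a : LineChart Y} (hc : c ∈ F.charts)
    (ha : a ∈ F.charts) {x : c.T} {s : ℝ} (h : c.φ.symm (s, x) ∈ a.dom) :
    ∀ᶠ r in 𝓝 s, c.φ.symm (r, x) ∈ a.dom ∧
      a.base (c.φ.symm (r, x)) = a.base (c.φ.symm (s, x)) := by
  have hm := mem_nhdsWithin_iff_eventually.1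
    ((F.isFoliatedAtlas.coherent c hc a ha).mem (c.symm_mem (s, x)) h)
  have hcont : Continuous fun r => c.φ.symm (r, x) := c.continuous_symm.comp (by fun_prop)
  filter_upwards [(hcont.tendsto s).eventually hm] with r hr
  exact hr ⟨c.symm_mem _, by rw [c.base_symm, c.base_symm]⟩

/-- Two points on the same plaque that are close to `p` are related by the flow for a short
time. -/
theorem exists_flow_of_base_eq (hF : F.IsInducedBy α) {c : LineChart Y} (hc : c ∈ F.charts) {p : Y}
    (hp : p ∈ c.dom) {δ : ℝ} (hδ : 0 < δ) :
    ∃ W ∈ 𝓝 p, ∀ q ∈ W, ∀ q' ∈ W, c.base q = c.base q' → ∃ ε, |ε| < δ ∧ q' = α ε q := by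
  obtain ⟨a, ha, hpa, τ, hτ⟩ := hF p
  have hτc : ContinuousAt τ p := hτ.continuousOn.continuousAt (LineChart.dom_mem_nhds hpa)
  have hO : a.dom ∩ τ ⁻¹' Metric.ball (τ p) (δ / 2) ∈ 𝓝 p :=
    inter_mem (LineChart.dom_mem_nhds hpa)
      (hτc.preimage_mem_nhds (Metric.ball_mem_nhds _ (half_pos hδ)))
  have hO' : c.φ.symm ⁻¹' (a.dom ∩ τ ⁻¹' Metric.ball (τ p) (δ / 2)) ∈ 𝓝 (c.φ p) := by
    apply c.continuous_symm.continuousAt.preimage_mem_nhds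
    rwa [c.φ.left_inv hp]
  rw [show c.φ p = ((c.φ p).1, (c.φ p).2) from rfl, nhds_prod_eq, Filter.mem_prod_iff] at hO'
  obtain ⟨J, hJ, V, hV, hJV⟩ := hO'
  obtain ⟨ε, hε, hεJ⟩ := Metric.mem_nhds_iff.1 hJ
  refine ⟨c.dom ∩ c.φ ⁻¹' (Metric.ball (c.φ p).1 ε ×ˢ V), inter_mem (LineChart.dom_mem_nhds hp)
    ((c.φ.continuousAt hp).preimage_mem_nhds (prod_mem_nhds (Metric.ball_mem_nhds _ hε) hV)), ?_⟩
  rintro q ⟨hq, hqJ, hqV⟩ q' ⟨hq', hqJ', -⟩ e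
  -- In a box of `c`-coordinates, `q` and `q'` are joined by a segment of their plaque lying in the
  -- flow box `a`. Along it `a.base` is locally constant, so both points lie on one plaque of `a`
  -- and differ by the flow.
  have key : ∀ r ∈ Metric.ball (c.φ p).1 ε, c.φ.symm (r, c.base q) ∈
      a.dom ∩ τ ⁻¹' Metric.ball (τ p) (δ / 2) := fun r hr => hJV (mk_mem_prod (hεJ hr) hqV)
  have h1 := key _ hqJ
  have h2 := key _ hqJ'
  have h3 := (convex_ball (c.φ p).1 ε).isPreconnected.eq_of_eventually_eq
    (g := fun r => a.base (c.φ.symm (r, c.base q)))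
    (fun r hr => nhdsWithin_le_nhds
      ((F.eventually_base_symm hc ha (key r hr).1).mono fun _ h => h.2)) hqJ hqJ'
  rw [c.symm_base hq] at h1 h3
  rw [e, c.symm_base hq'] at h2 h3
  refine ⟨τ q' - τ q, ?_, hτ.eq_flow q h1.1 q' h2.1 h3⟩
  have b1 := h1.2
  have b2 := h2.2
  rw [mem_preimage, Metric.mem_ball, Real.dist_eq, abs_lt] at b1 b2
  rw [abs_lt]
  constructor <;> linarith [b1.1, b1.2, b2.1, b2.2]

/-- The transition map slides `q` along its `c`-plaque to the first coordinate of `p`. Near `p` this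
is a flow move for a short time, which does not change `c'.base`. -/
theorem eventually_transition (hF : F.IsInducedBy α) {c c' : LineChart Y} (hc : c ∈ F.charts)
    (hc' : c' ∈ F.charts) {p : Y} (hp : p ∈ c.dom) (hp' : p ∈ c'.dom) :
    ∀ᶠ q in 𝓝 p, c.transition c' p (c.base q) = c'.base q := by
  obtain ⟨δ, hδ, h1⟩ := hF.exists_base_flow_eq hc' hp'
  obtain ⟨W, hW, h2⟩ := hF.exists_flow_of_base_eq hc hp hδ
  have ht : Tendsto (fun q => c.φ.symm ((c.φ p).1, c.base q)) (𝓝 p) (𝓝 p) := by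
    have hcont : Continuous fun x => c.φ.symm ((c.φ p).1, x) := c.continuous_symm.comp (by fun_prop)
    have := (hcont.tendsto _).comp (LineChart.continuousAt_base hp)
    rwa [c.symm_base hp] at this
  filter_upwards [h1, hW, ht.eventually hW] with q q1 q2 q3
  obtain ⟨ε, hε, e⟩ := h2 q q2 _ q3 (c.base_symm _ _).symm
  unfold LineChart.transition
  rw [e, (q1 ε hε).2]

/-- `c.base` has a continuous section through `p`, so statements about points near `p` descend to
germs on the transversal. -/
theorem _root_.LineChart.eventually_of_eventually_base {c : LineChart Y} {p : Y} (hp : p ∈ c.dom)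
    {P : c.T → Prop} (h : ∀ᶠ q in 𝓝 p, P (c.base q)) : ∀ᶠ x in 𝓝 (c.base p), P x := by
  have hcont : Continuous fun x => c.φ.symm ((c.φ p).1, x) := c.continuous_symm.comp (by fun_prop)
  have ht := hcont.tendsto (c.base p)
  rw [c.symm_base hp] at ht
  filter_upwards [ht.eventually h] with x hx
  rwa [c.base_symm] at hx

theorem _root_.Flow.orbit_apply (α : Flow ℝ Y) (t : ℝ) (y : Y) : α.orbit (α t y) = α.orbit y := by
  ext z
  rw [Flow.mem_orbit_iff, Flow.mem_orbit_iff]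
  constructor
  · rintro ⟨s, rfl⟩
    exact ⟨s + t, α.map_add _ _ _⟩
  · rintro ⟨s, rfl⟩
    exact ⟨s - t, by rw [α.apply_apply, sub_add_cancel]⟩

/-- Flow boxes show that the orbit is locally constant along a plaque, which is a copy of `ℝ`.
Together with `sameLeaf_flow` this identifies leaves with orbits. -/
theorem mem_orbit_of_sameLeaf (hF : F.IsInducedBy α) {y z : Y} (h : F.SameLeaf y z) :
    z ∈ α.orbit y := by
  suffices h : α.orbit y = α.orbit z by
    rw [h]
    exact α.mem_orbit_self z
  induction h with
  | refl => rfl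
  | symm _ _ _ h => exact h.symm
  | trans _ _ _ _ _ h1 h2 => exact h1.trans h2
  | rel y z h =>
    obtain ⟨c, hc, x, ⟨hy, hyx⟩, hz, hzx⟩ := h
    have := isPreconnected_univ.eq_of_eventually_eq (g := fun r => α.orbit (c.φ.symm (r, x)))
      (fun r _ => nhdsWithin_le_nhds ?_) (mem_univ (c.φ y).1) (mem_univ (c.φ z).1)
    · nth_rewrite 1 [← hyx] at this
      rw [← hzx] at this
      rwa [c.symm_base hy, c.symm_base hz] at this
    · obtain ⟨a, ha, hpa, τ, hτ⟩ := hF (c.φ.symm (r, x))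
      filter_upwards [F.eventually_base_symm hc ha hpa] with s hs
      rw [hτ.eq_flow _ hpa _ hs.1 hs.2.symm, α.orbit_apply]

theorem sameLeaf_flow (hF : F.IsInducedBy α) (y : Y) (t : ℝ) : F.SameLeaf y (α t y) := by
  have := isPreconnected_univ.eq_of_eventually_eq (g := fun t : ℝ => F.SameLeaf y (α t y))
    (fun r _ => nhdsWithin_le_nhds ?_) (mem_univ 0) (mem_univ t)
  · rw [← this, α.map_zero_apply]
    exact Relation.EqvGen.refl _
  · obtain ⟨c, hc, hp, -⟩ := hF (α r y)
    filter_upwards [eventually_nhds_orbit (P := fun z => z ∈ c.dom ∧ c.base z = c.base (α r y))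
      (hF.eventually_base_orbit hc hp)] with s hs
    have : F.SameLeaf (α s y) (α r y) := Relation.EqvGen.rel _ _ ⟨c, hc, _, hs, hp, rfl⟩
    exact propext ⟨fun h => h.trans this, fun h => h.trans this.symm⟩

end IsInducedBy

end LineFoliation

theorem IsFoliatedAtlas.isInducedBy {Y : Type u} [TopologicalSpace Y] {α : Flow ℝ Y}
    (hA : IsFoliatedAtlas (openTubeCharts α)) : hA.foliation.IsInducedBy α := fun y => by
  obtain ⟨c, hc, hy⟩ := hA.covers y
  exact ⟨c, hA.coherent c hc, hy, exists_isFlowBox_of_mem_openTubeCharts hc⟩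

/-- A transitive relation between the endpoints of intervals which holds for short intervals holds
for all intervals. -/
theorem Real.rel_of_local {P : ℝ → ℝ → Prop}
    (htrans : ∀ a b c, a ≤ b → b ≤ c → P a b → P b c → P a c) {a b : ℝ}
    (hloc : ∀ s ∈ Icc a b, ∃ V ∈ 𝓝 s, ∀ p ∈ V, ∀ q ∈ V, p ≤ q → P p q) (hab : a ≤ b) : P a b := by
  choose V hV hP using fun s : Icc a b => hloc s s.2
  obtain ⟨t, ht0, hmono, ⟨m, hm⟩, ht⟩ := exists_monotone_Icc_subset_open_cover_Icc hab
    (c := fun s : Icc a b => Subtype.val ⁻¹' interior (V s))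
    (fun s => isOpen_interior.preimage continuous_subtype_val)
    (fun s _ => mem_iUnion.2 ⟨s, mem_interior_iff_mem_nhds.2 (hV s)⟩)
  have key : ∀ n, P a (t n) := fun n => by
    induction n with
    | zero =>
      rw [ht0]
      exact hP ⟨a, ⟨le_rfl, hab⟩⟩ a (mem_of_mem_nhds (hV ⟨a, _⟩)) a
        (mem_of_mem_nhds (hV ⟨a, _⟩)) le_rfl
    | succ n ih =>
      obtain ⟨i, hi⟩ := ht n
      have hle := hmono n.le_succ
      exact htrans _ _ _ (t n).2.1 hle ih (hP i _ (interior_subset (hi ⟨le_rfl, hle⟩)) _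
        (interior_subset (hi ⟨hle, le_rfl⟩)) hle)
  simpa [hm m le_rfl] using key m

/-- The function that continues `u` after the time `m` with the increments of `v`. -/
noncomputable def glue (m : ℝ) (u v : ℝ → ℝ) (r : ℝ) : ℝ := if r ≤ m then u r else v r + (u m - v m)

theorem glue_of_le {m r : ℝ} (h : r ≤ m) (u v : ℝ → ℝ) : glue m u v r = u r := if_pos h

theorem glue_of_ge {m r : ℝ} (h : m ≤ r) (u v : ℝ → ℝ) :
    glue m u v r = v r + (u m - v m) := by
  rcases h.eq_or_lt with rfl | h
  · rw [glue_of_le le_rfl]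
    ring
  · exact if_neg h.not_ge

theorem continuous_glue (m : ℝ) {u v : ℝ → ℝ} (hu : Continuous u) (hv : Continuous v) :
    Continuous (glue m u v) := by
  refine Continuous.if_le hu (hv.add continuous_const) continuous_id continuous_const ?_
  rintro r rfl
  ring

/-! ### Time functions of leaf paths and their holonomy -/

namespace LineFoliation

variable {Y : Type u} [TopologicalSpace Y] {F : LineFoliation Y} {α : Flow ℝ Y}

namespace IsInducedBy

/-- An orbit meets only countably many plaques of a chart. -/
theorem countable_base_orbit (hF : F.IsInducedBy α) {c : LineChart Y} (hc : c ∈ F.charts) (x : Y) :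
    (c.base '' (c.dom ∩ α.orbit x)).Countable := by
  -- The base is locally constant in time, so each of its values on the orbit is attained at a
  -- rational time.
  refine (countable_range fun q : ℚ => c.base (α (q : ℝ) x)).mono ?_
  rintro _ ⟨_, ⟨hz, t, rfl⟩, rfl⟩
  have h := eventually_nhds_orbit (α := α) (v := t) (z := x)
    (P := fun z => c.base z = c.base (α t x)) ((hF.eventually_base_orbit hc hz).mono fun _ h => h.2)
  obtain ⟨_, ⟨q, rfl⟩, hq⟩ := (Rat.denseRange_cast (𝕜 := ℝ)).inter_nhds_nonempty h
  exact ⟨q, hq⟩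

/-- Locally the base of `f s` runs through a connected countable subset of a metrizable space, hence
is constant; the time function is then read off a flow box. Increments are glued over a subdivision
of the interval. -/
theorem exists_lift (hF : F.IsInducedBy α) {f : ℝ → Y} (hf : Continuous f) {x : Y}
    (hx : ∀ s, f s ∈ α.orbit x) {a b : ℝ} (hab : a ≤ b) :
    ∃ u : ℝ → ℝ, Continuous u ∧ u a = 0 ∧ ∀ s ∈ Icc a b, f s = α (-u s) (f a) := by
  refine Real.rel_of_local (P := fun a b => ∃ u : ℝ → ℝ, Continuous u ∧ u a = 0 ∧
    ∀ s ∈ Icc a b, f s = α (-u s) (f a)) ?_ ?_ hab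
  · rintro a b c hab hbc ⟨u, hu, hu0, h⟩ ⟨v, hv, hv0, k⟩
    refine ⟨glue b u v, continuous_glue b hu hv, by rw [glue_of_le hab, hu0], fun s hs => ?_⟩
    rcases le_total s b with hsb | hsb
    · rw [glue_of_le hsb, h s ⟨hs.1, hsb⟩]
    · rw [glue_of_ge hsb, k s ⟨hsb, hs.2⟩, h b ⟨hab, le_rfl⟩, α.apply_apply, hv0]
      congr 1
      ring
  · intro s₀ _
    obtain ⟨c, hc, hp, τ, hτ⟩ := hF (f s₀)
    obtain ⟨δ, hδ, hd⟩ := Metric.mem_nhds_iff.1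
      (hf.continuousAt.preimage_mem_nhds (LineChart.dom_mem_nhds hp))
    refine ⟨_, Metric.ball_mem_nhds s₀ hδ, fun a ha b hb hab => ?_⟩
    have hI : Icc a b ⊆ Metric.ball s₀ δ := (convex_ball s₀ δ).ordConnected.out ha hb
    have hbase : ∀ s ∈ Icc a b, c.base (f s) = c.base (f a) := fun s hs => by
      let _ := TopologicalSpace.metrizableSpaceMetric c.T
      have hpre : IsPreconnected ((fun s => c.base (f s)) '' Icc a b) :=
        isPreconnected_Icc.image _ fun s hs =>
          ((LineChart.continuousAt_base (hd (hI hs))).comp hf.continuousAt).continuousWithinAt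
      have hcount := (hF.countable_base_orbit hc x).mono (s₁ := (fun s => c.base (f s)) '' Icc a b)
        (by
          rintro _ ⟨s, hs, rfl⟩
          exact ⟨f s, ⟨hd (hI hs), hx s⟩, rfl⟩)
      exact hcount.isTotallyDisconnected _ subset_rfl hpre ⟨s, hs, rfl⟩ ⟨a, ⟨le_rfl, hab⟩, rfl⟩
    -- The projection makes the time function continuous on all of `ℝ`. The sign matches the
    -- convention `f s = α (-u s) (f a)`.
    refine ⟨fun s => τ (f a) - τ (f (projIcc a b hab s)), ?_, ?_, fun s hs => ?_⟩
    · refine continuous_const.sub (hτ.continuousOn.comp_continuous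
        (hf.comp (continuous_subtype_val.comp continuous_projIcc)) fun s => hd (hI (Subtype.prop _)))
    · simp
    · beta_reduce
      rw [projIcc_of_mem hab hs, neg_sub]
      exact hτ.eq_flow _ (hd ha) _ (hd (hI hs)) (hbase s hs).symm

theorem isLeafPath_of_lift (hF : F.IsInducedBy α) {x z : Y} {γ : Path x z} {u : ℝ → ℝ}
    (h : ∀ s ∈ Icc (0 : ℝ) 1, γ.extend s = α (-u s) x) : F.IsLeafPath γ := fun s => by
  rw [← γ.extend_apply s.2, h s s.2]
  exact hF.sameLeaf_flow _ _

theorem exists_lift_path (hF : F.IsInducedBy α) {x z : Y} {γ : Path x z} (hγ : F.IsLeafPath γ) :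
    ∃ u : ℝ → ℝ, Continuous u ∧ u 0 = 0 ∧ ∀ s ∈ Icc (0 : ℝ) 1, γ.extend s = α (-u s) x := by
  have := hF.exists_lift γ.continuous_extend (x := x)
    (fun s => hF.mem_orbit_of_sameLeaf (hγ (projIcc 0 1 zero_le_one s))) zero_le_one
  rwa [γ.extend_zero] at this

/-- Along a path in an orbit the holonomy is given by the flow. -/
theorem holonomyMap_eventuallyEq (hF : F.IsInducedBy α) {f : ℝ → Y} {x : Y} {u : ℝ → ℝ}
    (hu : Continuous u) {c c' : LineChart Y} {a b : ℝ} {h : c.T → c'.T}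
    (H : F.IsHolonomyMap f c a c' b h) (hf : ∀ s ∈ Icc a b, f s = α (-u s) x) :
    ∀ᶠ q in 𝓝 (f a), h (c.base q) = c'.base (α (-(u b - u a)) q) := by
  induction H with
  | transition c c' a hc hc' h h' =>
    simpa using hF.eventually_transition hc hc' h h'
  | plaque c a b hc hab y h =>
    -- `u` need not be monotone, but by the intermediate value theorem it takes every value between
    -- `u a` and `u b`. So the orbit segment between the endpoints lies in the chart, and by
    -- compactness so do the nearby segments.
    have hmem : ∀ w ∈ uIcc (0 : ℝ) (-(u b - u a)), α w (f a) ∈ c.dom := fun w hw => by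
      have : u a - w ∈ uIcc (u a) (u b) := by
        have := (mem_image_of_mem (fun w => u a - w) hw)
        rw [image_const_sub_uIcc] at this
        simpa using this
      obtain ⟨s, hs, e⟩ := intermediate_value_uIcc hu.continuousOn this
      rw [uIcc_of_le hab] at hs
      have := (h s hs).1
      rw [hf s hs, e] at this
      rw [hf a ⟨le_rfl, hab⟩, α.apply_apply]
      convert this using 2
      ring
    have hev : ∀ᶠ q in 𝓝 (f a), ∀ w ∈ uIcc (0 : ℝ) (-(u b - u a)), α w q ∈ c.dom := by
      refine isCompact_uIcc.eventually_forall_of_forall_eventually fun w hw => ?_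
      have hcont : Continuous fun p : Y × ℝ => α p.2 p.1 :=
        α.continuous continuous_snd continuous_fst
      exact (hcont.tendsto (f a, w)).eventually (LineChart.dom_mem_nhds (hmem w hw))
    filter_upwards [hev] with q hq
    have := hF.base_orbit_eq hc isPreconnected_uIcc hq left_mem_uIcc right_mem_uIcc
    rw [α.map_zero_apply] at this
    exact this
  | @comp c c' c'' a b d h k H1 H2 h1 h2 =>
    have e1 := h1 fun s hs => hf s ⟨hs.1, hs.2.trans H2.le⟩
    have e2 := h2 fun s hs => hf s ⟨H1.le.trans hs.1, hs.2⟩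
    have hb : f b = α (-(u b - u a)) (f a) := by
      rw [hf b ⟨H1.le, H2.le⟩, hf a ⟨le_rfl, H1.le.trans H2.le⟩, α.apply_apply]
      congr 1
      ring
    have ht := α.tendsto_nhds (-(u b - u a)) (f a)
    rw [← hb] at ht
    filter_upwards [e1, ht.eventually e2] with q q1 q2
    rw [Function.comp_apply, q1, q2, α.apply_apply]
    congr 2
    ring

theorem exists_holonomyMap (hF : F.IsInducedBy α) {f : ℝ → Y} {x : Y} {u : ℝ → ℝ}
    (hu : Continuous u) {a b : ℝ} (hab : a ≤ b) (hf : ∀ s ∈ Icc a b, f s = α (-u s) x)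
    {c c' : LineChart Y} (hc : c ∈ F.charts) (hc' : c' ∈ F.charts) (ha : f a ∈ c.dom)
    (hb : f b ∈ c'.dom) : ∃ h, F.IsHolonomyMap f c a c' b h := by
  -- Transition maps at the endpoints replace any charts by the prescribed ones, so the charts may
  -- be left free.
  suffices ∃ (e e' : LineChart Y) (h : e.T → e'.T),
      F.IsHolonomyMap (fun s => α (-u s) x) e a e' b h by
    obtain ⟨e, e', h, H⟩ := this
    have H := H.congr (g := f) fun s hs => (hf s hs).symm
    exact ⟨_, ((IsHolonomyMap.transition c e a hc H.left.1 ha H.left.2).comp H).comp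
      (IsHolonomyMap.transition e' c' b H.right.1 hc' H.right.2 hb)⟩
  refine Real.rel_of_local (P := fun a b => ∃ (e e' : LineChart Y) (h : e.T → e'.T),
      F.IsHolonomyMap (fun s => α (-u s) x) e a e' b h) ?_ (fun s _ => ?_) hab
  · rintro a b d - - ⟨e, e', h, H⟩ ⟨k, k', l, K⟩
    exact ⟨_, _, _, (H.comp (IsHolonomyMap.transition e' k b H.right.1 K.left.1
      H.right.2 K.left.2)).comp K⟩
  · obtain ⟨c, hc, hp, -⟩ := hF (α (-u s) x)
    have h1 := eventually_nhds_orbit (P := fun z => z ∈ c.dom ∧ c.base z = c.base (α (-u s) x))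
      (hF.eventually_base_orbit hc hp)
    obtain ⟨δ, hδ, hd⟩ := Metric.eventually_nhds_iff_ball.1 ((hu.neg.tendsto s).eventually h1)
    refine ⟨_, Metric.ball_mem_nhds s hδ, fun p hp' q hq hpq => ⟨c, c, id, ?_⟩⟩
    exact IsHolonomyMap.plaque c p q hc hpq _ fun r hr =>
      hd r ((convex_ball s δ).ordConnected.out hp' hq hr)

/-- All chains of charts give the germ induced by `α (-u 1)`. The existence part ensures that
equality of two germ sets carries information. -/
theorem holonomyGerms_eq (hF : F.IsInducedBy α) {x z : Y} {γ : Path x z} {u : ℝ → ℝ}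
    (hu : Continuous u) (hu0 : u 0 = 0) (h : ∀ s ∈ Icc (0 : ℝ) 1, γ.extend s = α (-u s) x)
    {c c' : LineChart Y} (hc : c ∈ F.charts) (hc' : c' ∈ F.charts) (hx : x ∈ c.dom)
    (hz : z ∈ c'.dom) :
    (∃ k, F.IsHolonomyMap γ.extend c 0 c' 1 k) ∧
    F.holonomyGerms γ c c' =
      {g | ∃ k : c.T → c'.T, (∀ᶠ q in 𝓝 x, k (c.base q) = c'.base (α (-u 1) q)) ∧
        (k : Filter.Germ (𝓝 (c.base x)) c'.T) = g} := by
  obtain ⟨k₀, hk₀⟩ := hF.exists_holonomyMap hu zero_le_one h hc hc'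
    (by rwa [γ.extend_zero]) (by rwa [γ.extend_one])
  have key : ∀ k, F.IsHolonomyMap γ.extend c 0 c' 1 k →
      ∀ᶠ q in 𝓝 x, k (c.base q) = c'.base (α (-u 1) q) := fun k hk => by
    have := hF.holonomyMap_eventuallyEq hu hk h
    rwa [γ.extend_zero, hu0, sub_zero] at this
  refine ⟨⟨k₀, hk₀⟩, Subset.antisymm ?_ ?_⟩
  · rintro g ⟨k, hk, rfl⟩
    exact ⟨k, key k hk, rfl⟩
  · rintro g ⟨k, hk, rfl⟩
    refine ⟨k₀, hk₀, Filter.Germ.coe_eq.2 ?_⟩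
    refine LineChart.eventually_of_eventually_base hx (P := fun y => k₀ y = k y) ?_
    filter_upwards [key k₀ hk₀, hk] with q q1 q2
    rw [q1, q2]

end IsInducedBy

end LineFoliation

/-! ### Local periods and equality of holonomy classes -/

namespace Flow

variable {Y : Type u} [TopologicalSpace Y] (α : Flow ℝ Y)

/-- The time `p` is a holonomy period at `y`: all points near `y` return to themselves after a
time close to `p`. -/
def IsLocalPeriod (y : Y) (p : ℝ) : Prop :=
  ∀ δ > 0, ∀ᶠ q in 𝓝 y, ∃ ε, |ε| < δ ∧ α (p + ε) q = q

variable {α}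

theorem IsLocalPeriod.zero (y : Y) : α.IsLocalPeriod y 0 := fun δ hδ =>
  Eventually.of_forall fun q => ⟨0, by simpa using hδ, by simp⟩

theorem IsLocalPeriod.eq [T2Space Y] {y : Y} {p : ℝ} (h : α.IsLocalPeriod y p) : α p y = y := by
  by_contra hne
  have hc : Continuous fun ε : ℝ => α (p + ε) y :=
    α.continuous (continuous_const.add continuous_id) continuous_const
  have h0 : (fun ε : ℝ => α (p + ε) y) 0 ≠ y := by simpa using hne
  obtain ⟨δ, hδ, hd⟩ := Metric.eventually_nhds_iff.1 (hc.continuousAt.eventually_ne h0)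
  obtain ⟨ε, hε, e⟩ := (h δ hδ).self_of_nhds
  exact hd (by simpa using hε) e

end Flow

namespace LineFoliation

variable {Y : Type u} [TopologicalSpace Y] {F : LineFoliation Y} {α : Flow ℝ Y}

namespace IsInducedBy

/-- At the points near `y` there is a local period close to a given local period at `y`. -/
theorem eventually_isLocalPeriod [T2Space Y] (hF : F.IsInducedBy α) {y : Y} {p : ℝ}
    (h : α.IsLocalPeriod y p) {δ : ℝ} (hδ : 0 < δ) :
    ∀ᶠ q in 𝓝 y, ∃ ε, |ε| < δ ∧ α.IsLocalPeriod q (p + ε) := by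
  obtain ⟨δ₀, hδ₀, hfree⟩ := hF.exists_forall_flow_ne y
  -- Two return times of `q` within `η` of `p` differ by less than `δ₀`, hence coincide; so `p + ε`
  -- is the only one.
  set η := min δ (δ₀ / 2)
  have hη0 : 0 < η := lt_min hδ (half_pos hδ₀)
  have h1 : η ≤ δ := min_le_left _ _
  have h2 : η ≤ δ₀ / 2 := min_le_right _ _
  filter_upwards [(h η hη0).eventually_nhds, hfree] with q hq hqf
  obtain ⟨ε, hε, e⟩ := hq.self_of_nhds
  refine ⟨ε, hε.trans_le h1, fun κ hκ => ?_⟩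
  have hC : IsCompact (Icc (-η) η \ Ioo (ε - κ) (ε + κ)) := isCompact_Icc.diff isOpen_Ioo
  have hne : ∀ ζ ∈ Icc (-η) η \ Ioo (ε - κ) (ε + κ), α (p + ζ) q ≠ q := by
    rintro ζ ⟨hζ, hζ'⟩ e'
    rw [abs_lt] at hε
    have : ζ - ε = 0 := by
      refine hqf _ ?_ ?_
      · rw [abs_lt]
        constructor <;> linarith [hζ.1, hζ.2]
      · nth_rewrite 1 [← e]
        rw [α.apply_apply]
        convert e' using 2
        ring
    exact hζ' ⟨by linarith, by linarith⟩
  -- By compactness, points near `q` have no return time `p + ζ` with `|ζ| ≤ η` that is at distance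
  -- `κ` or more from `p + ε`. They do return at some time within `η` of `p`, which must therefore
  -- be close to `p + ε`.
  have hev : ∀ᶠ q' in 𝓝 q, ∀ ζ ∈ Icc (-η) η \ Ioo (ε - κ) (ε + κ), α (p + ζ) q' ≠ q' := by
    refine hC.eventually_forall_of_forall_eventually fun ζ hζ => ?_
    have hcont : Continuous fun z : Y × ℝ => α (p + z.2) z.1 :=
      α.continuous (continuous_const.add continuous_snd) continuous_fst
    exact (isOpen_ne_fun hcont continuous_fst).mem_nhds (x := (q, ζ)) (hne ζ hζ)
  filter_upwards [hq, hev] with q' hq' hq''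
  obtain ⟨ε', hε', e'⟩ := hq'
  refine ⟨ε' - ε, ?_, by convert e' using 2; ring⟩
  have : ε' ∈ Ioo (ε - κ) (ε + κ) := by
    by_contra hn
    exact hq'' ε' ⟨abs_le.1 hε'.le, hn⟩ e'
  rw [abs_lt]
  constructor <;> linarith [this.1, this.2]

/-- Two flow times have the same holonomy if and only if they differ by a local period. -/
theorem eventually_base_eq_iff (hF : F.IsInducedBy α) {x z : Y} {t t' : ℝ} (ht : α (-t) x = z)
    (ht' : α (-t') x = z) :
    (∀ c' ∈ F.charts, z ∈ c'.dom →
      ∀ᶠ q in 𝓝 x, c'.base (α (-t) q) = c'.base (α (-t') q)) ↔ α.IsLocalPeriod x (t - t') := by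
  have l1 := α.tendsto_nhds (-t) x
  have l2 := α.tendsto_nhds (-t') x
  rw [ht] at l1
  rw [ht'] at l2
  constructor
  · intro h δ hδ
    obtain ⟨c', hc', hz, -⟩ := hF z
    obtain ⟨W, hW, hWδ⟩ := hF.exists_flow_of_base_eq hc' hz hδ
    filter_upwards [h c' hc' hz, l1.eventually hW, l2.eventually hW] with q q0 q1 q2
    obtain ⟨ε, hε, e⟩ := hWδ _ q2 _ q1 q0.symm
    refine ⟨ε, hε, ?_⟩
    have e2 := congrArg (α t) e
    rw [α.apply_apply, α.apply_apply, α.apply_apply, add_neg_cancel, α.map_zero_apply] at e2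
    nth_rewrite 2 [e2]
    congr 1
    ring
  · intro h c' hc' hz
    obtain ⟨δ, hδ, hd⟩ := hF.exists_base_flow_eq hc' hz
    filter_upwards [h δ hδ, l2.eventually hd] with q q1 q2
    obtain ⟨ε, hε, e⟩ := q1
    rw [← (q2 ε hε).2]
    nth_rewrite 1 [← e]
    rw [α.apply_apply, α.apply_apply]
    congr 2
    ring

theorem holonomyClass_eq_iff (hF : F.IsInducedBy α) {x z : Y} {γ γ' : Path x z}
    (hγ : F.IsLeafPath γ) (hγ' : F.IsLeafPath γ') {u u' : ℝ → ℝ}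
    (hu : Continuous u) (hu0 : u 0 = 0) (h : ∀ s ∈ Icc (0 : ℝ) 1, γ.extend s = α (-u s) x)
    (hu' : Continuous u') (hu0' : u' 0 = 0)
    (h' : ∀ s ∈ Icc (0 : ℝ) 1, γ'.extend s = α (-u' s) x) :
    F.holonomyClass γ hγ = F.holonomyClass γ' hγ' ↔ α.IsLocalPeriod x (u 1 - u' 1) := by
  have e1 := h 1 ⟨zero_le_one, le_rfl⟩
  have e2 := h' 1 ⟨zero_le_one, le_rfl⟩
  rw [Path.extend_one] at e1 e2
  rw [← hF.eventually_base_eq_iff e1.symm e2.symm]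
  refine (Quotient.eq (r := F.holonomySetoid x z)).trans ?_
  change (∀ c ∈ F.charts, ∀ c' ∈ F.charts, x ∈ c.dom → z ∈ c'.dom →
    F.holonomyGerms γ c c' = F.holonomyGerms γ' c c') ↔ _
  constructor
  · intro H c' hc' hz
    obtain ⟨c, hc, hx, -⟩ := hF x
    have H := H c hc c' hc' hx hz
    obtain ⟨⟨k, hk⟩, E⟩ := hF.holonomyGerms_eq hu hu0 h hc hc' hx hz
    obtain ⟨-, E'⟩ := hF.holonomyGerms_eq hu' hu0' h' hc hc' hx hz
    have m1 : (k : Filter.Germ (𝓝 (c.base x)) c'.T) ∈ F.holonomyGerms γ c c' := ⟨k, hk, rfl⟩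
    have m2 := m1
    rw [E] at m1
    rw [H, E'] at m2
    obtain ⟨k₁, p1, q1⟩ := m1
    obtain ⟨k₂, p2, q2⟩ := m2
    have q := Filter.Germ.coe_eq.1 (q1.trans q2.symm)
    filter_upwards [p1, p2, (LineChart.continuousAt_base hx).eventually q] with w w1 w2 w3
    rw [← w1, ← w2, w3]
  · intro H c hc c' hc' hx hz
    rw [(hF.holonomyGerms_eq hu hu0 h hc hc' hx hz).2,
      (hF.holonomyGerms_eq hu' hu0' h' hc hc' hx hz).2]
    have H := H c' hc' hz
    ext g
    constructor
    · rintro ⟨k, hk, e⟩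
      exact ⟨k, by filter_upwards [hk, H] with q q1 q2 using q1.trans q2, e⟩
    · rintro ⟨k, hk, e⟩
      exact ⟨k, by filter_upwards [hk, H] with q q1 q2 using q1.trans q2.symm, e⟩

theorem extend_orbitPath (α : Flow ℝ Y) (x : Y) (t : ℝ) :
    ∀ s ∈ Icc (0 : ℝ) 1, (orbitPath α x t).extend s = α (-(t * s)) x := fun s hs => by
  rw [Path.extend_apply _ hs]
  rfl

theorem isLeafPath_orbitPath (hF : F.IsInducedBy α) (x : Y) (t : ℝ) :
    F.IsLeafPath (orbitPath α x t) := hF.isLeafPath_of_lift (extend_orbitPath α x t)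

/-- The map from the transformation groupoid to the holonomy groupoid. -/
def orbitArrow (hF : F.IsInducedBy α) (p : Y × ℝ) : F.HolonomyGroupoid :=
  ⟨p.1, α (-p.2) p.1, F.holonomyClass (orbitPath α p.1 p.2) (hF.isLeafPath_orbitPath p.1 p.2)⟩

/-- A leaf path and the orbit path with the same total time have time difference `0`, which is a
local period. This reduces surjectivity, products and inverses to computing total times. -/
theorem mk_eq_orbitArrow (hF : F.IsInducedBy α) {x z : Y} {γ : Path x z} (hγ : F.IsLeafPath γ)
    {u : ℝ → ℝ} (hu : Continuous u) (hu0 : u 0 = 0)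
    (h : ∀ s ∈ Icc (0 : ℝ) 1, γ.extend s = α (-u s) x) :
    (⟨x, z, F.holonomyClass γ hγ⟩ : F.HolonomyGroupoid) = hF.orbitArrow (x, u 1) := by
  have e := h 1 ⟨zero_le_one, le_rfl⟩
  rw [Path.extend_one] at e
  subst e
  unfold orbitArrow
  congr 1
  rw [hF.holonomyClass_eq_iff hγ _ hu hu0 h (u' := fun s => u 1 * s) (by fun_prop) (by simp)
    (extend_orbitPath α x (u 1))]
  simpa using Flow.IsLocalPeriod.zero x

theorem orbitArrow_eq_iff [T2Space Y] (hF : F.IsInducedBy α) {x y : Y} {t s : ℝ} :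
    hF.orbitArrow (x, t) = hF.orbitArrow (y, s) ↔ x = y ∧ α.IsLocalPeriod x (t - s) := by
  -- The classes live over the endpoints `α (-t) x` and `α (-s) x`, which are only propositionally
  -- equal. A variable endpoint `z` allows substitution.
  have key : ∀ z (e : α (-s) x = z) (γ : Path x z) (hγ : F.IsLeafPath γ)
      (_ : ∀ r ∈ Icc (0 : ℝ) 1, γ.extend r = α (-(t * r)) x),
      (⟨x, z, F.holonomyClass γ hγ⟩ : F.HolonomyGroupoid) = hF.orbitArrow (x, s) ↔
        α.IsLocalPeriod x (t - s) := by
    rintro z rfl γ hγ hl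
    have := hF.holonomyClass_eq_iff hγ (hF.isLeafPath_orbitPath x s) (u := fun r => t * r)
      (u' := fun r => s * r) (by fun_prop) (by simp) hl (by fun_prop) (by simp)
      (extend_orbitPath α x s)
    simp only [mul_one] at this
    rw [← this]
    simp [orbitArrow]
  constructor
  · intro h
    obtain rfl : x = y := congrArg HolonomyGroupoid.range h
    have e : α (-t) x = α (-s) x := congrArg HolonomyGroupoid.source h
    exact ⟨rfl, (key _ e.symm _ (hF.isLeafPath_orbitPath x t) (extend_orbitPath α x t)).1 h⟩
  · rintro ⟨rfl, h⟩
    have e : α (-s) x = α (-t) x := by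
      have := congrArg (α (-t)) h.eq
      rw [α.apply_apply] at this
      rw [← this]
      congr 1
      ring
    exact (key _ e _ (hF.isLeafPath_orbitPath x t) (extend_orbitPath α x t)).2 h

theorem orbitArrow_surjective (hF : F.IsInducedBy α) : Function.Surjective hF.orbitArrow := by
  rintro ⟨x, z, g⟩
  induction g using Quotient.inductionOn with
  | h γ =>
    obtain ⟨γ, hγ⟩ := γ
    obtain ⟨u, hu, hu0, h⟩ := hF.exists_lift_path hγ
    exact ⟨_, (hF.mk_eq_orbitArrow hγ hu hu0 h).symm⟩

end IsInducedBy

end LineFoliation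

/-! ### Chains of charts; continuity and openness of `π` -/

namespace LineFoliation

variable {Y : Type u} [TopologicalSpace Y] {F : LineFoliation Y} {α : Flow ℝ Y}

/-- On the interval `[a, b]` the curve `f` passes successively through the domains of the charts
of the list. -/
def Follows (f : ℝ → Y) : ℝ → ℝ → List (LineChart Y) → Prop
  | a, b, [] => a = b
  | a, b, U :: L => ∃ m, a < m ∧ (∀ s ∈ Icc a m, f s ∈ U.dom) ∧ Follows f m b L

namespace Follows

variable {f g : ℝ → Y} {a b : ℝ} {L L' : List (LineChart Y)}

theorem le (h : Follows f a b L) : a ≤ b := by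
  induction L generalizing a with
  | nil => exact le_of_eq h
  | cons U L ih =>
    obtain ⟨m, hm, -, h⟩ := h
    exact hm.le.trans (ih h)

theorem congr (h : Follows f a b L) (hfg : ∀ s ∈ Icc a b, f s = g s) : Follows g a b L := by
  induction L generalizing a with
  | nil => exact h
  | cons U L ih =>
    obtain ⟨m, hm, hU, h⟩ := h
    exact ⟨m, hm, fun s hs => hfg s ⟨hs.1, hs.2.trans h.le⟩ ▸ hU s hs,
      ih h fun s hs => hfg s ⟨hm.le.trans hs.1, hs.2⟩⟩

theorem append_iff :
    Follows f a b (L ++ L') ↔ ∃ m, Follows f a m L ∧ Follows f m b L' := by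
  induction L generalizing a with
  | nil => simp [Follows]
  | cons U L ih =>
    constructor
    · rintro ⟨m, hm, hU, h⟩
      obtain ⟨k, h1, h2⟩ := ih.1 h
      exact ⟨k, ⟨m, hm, hU, h1⟩, h2⟩
    · rintro ⟨k, ⟨m, hm, hU, h1⟩, h2⟩
      exact ⟨m, hm, hU, ih.2 ⟨k, h1, h2⟩⟩

theorem affine {m q : ℝ} (hm : 0 < m) (hfg : ∀ s, g (m * s + q) = f s) (h : Follows f a b L) :
    Follows g (m * a + q) (m * b + q) L := by
  induction L generalizing a with
  | nil =>
    obtain rfl : a = b := h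
    rfl
  | cons U L ih =>
    obtain ⟨k, hk, hU, h⟩ := h
    refine ⟨m * k + q, by nlinarith, fun s hs => ?_, ih h⟩
    have e : s = m * ((s - q) / m) + q := by field_simp; ring
    rw [e, hfg]
    refine hU _ ⟨?_, ?_⟩
    · rw [le_div_iff₀ hm]; linarith [hs.1]
    · rw [div_le_iff₀ hm]; linarith [hs.2]

/-- The same division points work for nearby parameters, by compactness of each subinterval. -/
theorem eventually {X : Type*} [TopologicalSpace X] {f : X → ℝ → Y}
    (hf : Continuous fun p : X × ℝ => f p.1 p.2) {x : X} (h : Follows (f x) a b L) :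
    ∀ᶠ x' in 𝓝 x, Follows (f x') a b L := by
  induction L generalizing a with
  | nil => exact Eventually.of_forall fun _ => h
  | cons U L ih =>
    obtain ⟨m, hm, hU, h⟩ := h
    have hev : ∀ᶠ x' in 𝓝 x, ∀ s ∈ Icc a m, f x' s ∈ U.dom :=
      isCompact_Icc.eventually_forall_of_forall_eventually fun s hs =>
        (hf.tendsto (x, s)).eventually (LineChart.dom_mem_nhds (hU s hs))
    filter_upwards [hev, ih h] with x' h1 h2
    exact ⟨m, hm, h1, h2⟩

/-- Passage from subdivisions indexed by `Fin` to the recursive form, which suits induction and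
concatenation of chains. -/
theorem ofFn_iff {n : ℕ} {U : Fin n → LineChart Y} :
    (∃ t : Fin (n + 1) → ℝ, StrictMono t ∧ t 0 = a ∧ t (Fin.last n) = b ∧
      ∀ i : Fin n, ∀ s ∈ Icc (t i.castSucc) (t i.succ), f s ∈ (U i).dom) ↔
    Follows f a b (List.ofFn U) := by
  induction n generalizing a with
  | zero =>
    rw [List.ofFn_zero]
    constructor
    · rintro ⟨t, -, h0, h1, -⟩
      exact h0.symm.trans h1
    · intro h
      exact ⟨fun _ => a, fun i j hij => absurd hij (by omega), rfl, h, fun i => i.elim0⟩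
  | succ n ih =>
    rw [List.ofFn_succ]
    constructor
    · rintro ⟨t, ht, h0, h1, h⟩
      refine ⟨t 1, h0 ▸ ht Fin.zero_lt_one, fun s hs => h 0 s ?_, ih.1
        ⟨fun i => t i.succ, ht.comp (Fin.strictMono_succ), rfl, h1, fun i s hs => h i.succ s hs⟩⟩
      rw [← h0] at hs
      exact hs
    · rintro ⟨m, hm, hU, h⟩
      obtain ⟨t, ht, h0, h1, h⟩ := ih.2 h
      refine ⟨Fin.cons a t, Fin.strictMono_iff_lt_succ.2 fun i => ?_, rfl, ?_, fun i => ?_⟩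
      · cases i using Fin.cases with
        | zero => simpa [h0] using hm
        | succ i =>
          rw [← Fin.succ_castSucc, Fin.cons_succ, Fin.cons_succ]
          exact ht i.castSucc_lt_succ
      · rw [← Fin.succ_last, Fin.cons_succ, h1]
      · cases i using Fin.cases with
        | zero => simpa [h0] using hU
        | succ i =>
          rw [← Fin.succ_castSucc, Fin.cons_succ, Fin.cons_succ]
          exact h i

end Follows

namespace IsInducedBy

/-- A path following the chain may represent the arrow with another total time `u 1`; membership
sees `t` only up to a local period. -/
theorem orbitArrow_mem_chainSet [T2Space Y] (hF : F.IsInducedBy α) {y : Y} {t : ℝ} {n : ℕ}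
    {U : Fin n → LineChart Y} :
    hF.orbitArrow (y, t) ∈ F.chainSet U ↔ ∃ u : ℝ → ℝ, Continuous u ∧ u 0 = 0 ∧
      α.IsLocalPeriod y (u 1 - t) ∧ Follows (fun s => α (-u s) y) 0 1 (List.ofFn U) := by
  constructor
  · rintro ⟨γ, hγ, hU, e⟩
    change Path y (α (-t) y) at γ
    change F.holonomyClass γ hγ = _ at e
    obtain ⟨u, hu, hu0, h⟩ := hF.exists_lift_path hγ
    refine ⟨u, hu, hu0, ?_, (Follows.ofFn_iff.1 hU).congr h⟩
    have key : hF.orbitArrow (y, u 1) = hF.orbitArrow (y, t) :=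
      (hF.mk_eq_orbitArrow hγ hu hu0 h).symm.trans
        (congrArg (HolonomyGroupoid.mk y (α (-t) y)) e)
    exact (hF.orbitArrow_eq_iff.1 key).2
  · rintro ⟨u, hu, hu0, hp, h⟩
    have e := hF.orbitArrow_eq_iff.2 ⟨rfl, hp⟩
    rw [← e]
    let γ : Path y (α (-u 1) y) :=
      { toFun := fun s => α (-u s) y
        continuous_toFun := α.continuous (hu.comp continuous_subtype_val).neg continuous_const
        source' := by simp [hu0]
        target' := by simp }
    have hl : ∀ s ∈ Icc (0 : ℝ) 1, γ.extend s = α (-u s) y := fun s hs => γ.extend_apply hs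
    have hγ : F.IsLeafPath γ := hF.isLeafPath_of_lift hl
    refine ⟨γ, hγ, Follows.ofFn_iff.2 (h.congr fun s hs => (hl s hs).symm), ?_⟩
    have := hF.mk_eq_orbitArrow hγ hu hu0 hl
    rw [orbitArrow, HolonomyGroupoid.mk.injEq] at this
    exact eq_of_heq this.2.2

theorem continuous_orbitArrow [T2Space Y] (hF : F.IsInducedBy α) : Continuous hF.orbitArrow := by
  rw [continuous_generateFrom_iff]
  rintro _ ⟨n, U, -, rfl⟩
  rw [isOpen_iff_mem_nhds]
  rintro ⟨y, t⟩ hm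
  obtain ⟨u, hu, hu0, hp, h⟩ := hF.orbitArrow_mem_chainSet.1 hm
  have hev := Follows.eventually (X := Y × ℝ) (x := (y, 0))
    (f := fun z s => α (-(u s + s * z.2)) z.1) (a := 0) (b := 1) (L := List.ofFn U)
    (α.continuous (by fun_prop) (by fun_prop)) (by simpa using h)
  rw [nhds_prod_eq] at hev
  obtain ⟨P, hP, Q, hQ, hPQ⟩ := eventually_prod_iff.1 hev
  obtain ⟨δ, hδ, hd⟩ := Metric.eventually_nhds_iff.1 hQ
  have h1 := (hF.eventually_isLocalPeriod hp (half_pos hδ)).and hP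
  rw [nhds_prod_eq]
  filter_upwards [h1.prod_mk (Metric.ball_mem_nhds t (half_pos hδ))] with ⟨y', t'⟩ hz
  obtain ⟨⟨⟨ε, hε, hp'⟩, hy'⟩, ht'⟩ := hz
  -- The linear term makes the total time differ from `t'` by exactly the local period `u 1 - t + ε`
  -- at `y'`. It is small enough for the curve to follow the same chain.
  refine hF.orbitArrow_mem_chainSet.2 ⟨fun s => u s + s * (ε + (t' - t)), by fun_prop,
    by simp [hu0], ?_, hPQ hy' (hd ?_)⟩
  · convert hp' using 1
    ring
  · rw [dist_zero_right, Real.norm_eq_abs]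
    have : |t' - t| < δ / 2 := ht'
    linarith [abs_add_le ε (t' - t)]

/-- For every neighbourhood of `(y, t)` there is a chain of charts which is followed by an orbit
curve that starts at `y` and takes the total time `t`, and such that the starting point and the
total time of every orbit curve following the chain are in that neighbourhood. -/
def HasChain (F : LineFoliation Y) (α : Flow ℝ Y) (y : Y) (t : ℝ) : Prop :=
  ∀ W ∈ 𝓝 y, ∀ η > 0, ∃ L : List (LineChart Y), (∀ c ∈ L, c ∈ F.charts) ∧
    (∃ (u : ℝ → ℝ) (a b : ℝ), a < b ∧ Continuous u ∧ u a = 0 ∧ u b = t ∧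
      Follows (fun s => α (-u s) y) a b L) ∧
    ∀ (x : Y) (u : ℝ → ℝ) (a b : ℝ), Continuous u → Follows (fun s => α (-u s) x) a b L →
      α (-u a) x ∈ W ∧ |u b - u a - t| < η

theorem HasChain.trans {y : Y} {t s : ℝ} (h : HasChain F α y t)
    (k : HasChain F α (α (-t) y) s) : HasChain F α y (t + s) := by
  intro W hW η hη
  obtain ⟨L, hL, ⟨u, a, b, hab, hu, hua, hub, huL⟩, hL'⟩ := h W hW (η / 2) (half_pos hη)
  -- Only the first chain has to control the starting point, so `univ` suffices here.
  obtain ⟨M, hM, ⟨v, d, e, hde, hv, hvd, hve, hvM⟩, hM'⟩ := k univ univ_mem (η / 2) (half_pos hη)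
  refine ⟨L ++ M, fun c hc => (List.mem_append.1 hc).elim (hL c) (hM c), ?_, ?_⟩
  · have h1 : b ≤ e + (b - d) := by linarith
    refine ⟨glue b u fun r => v (r - (b - d)), a, e + (b - d), by linarith,
      continuous_glue b hu (hv.comp (continuous_sub_right _)), ?_, ?_,
      Follows.append_iff.2 ⟨b, ?_, ?_⟩⟩
    · rw [glue_of_le hab.le, hua]
    · rw [glue_of_ge h1, add_sub_cancel_right, sub_sub_cancel, hve, hvd, hub]
      ring
    · exact huL.congr fun r hr => by rw [glue_of_le hr.2]
    · have := hvM.affine (m := 1) (q := b - d) (g := fun r => α (-v (r - (b - d))) (α (-t) y))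
        one_pos (fun r => by simp)
      rw [one_mul, one_mul, add_sub_cancel] at this
      refine this.congr fun r hr => ?_
      rw [glue_of_ge hr.1, α.apply_apply, sub_sub_cancel, hvd, hub]
      congr 1
      ring
  · intro x w p q hw hf
    obtain ⟨m, h1, h2⟩ := Follows.append_iff.1 hf
    obtain ⟨k1, k2⟩ := hL' x w p m hw h1
    obtain ⟨-, k3⟩ := hM' x w m q hw h2
    refine ⟨k1, ?_⟩
    have := abs_add_le (w m - w p - t) (w q - w m - s)
    rw [show w q - w p - (t + s) = (w m - w p - t) + (w q - w m - s) by ring]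
    linarith

/-- The chain is a flow box `c` between two small charts `U` at `y` and `V` at `α (-t) y`, both
inside `c.dom`. A curve following it never leaves `c.dom`, so its total time is a difference of
values of `τ`, each known up to `η / 2`. -/
theorem eventually_hasChain (hF : F.IsInducedBy α)
    (hsmall : ∀ y, ∀ W ∈ 𝓝 y, ∃ c ∈ F.charts, y ∈ c.dom ∧ c.dom ⊆ W) (p : Y) :
    ∃ δ > 0, ∀ᶠ y in 𝓝 p, ∀ t : ℝ, |t| < δ → HasChain F α y t := by
  obtain ⟨c, hc, hp, τ, hτ⟩ := hF p
  obtain ⟨δ, hδ, hd⟩ := α.eventually_forall_mem (LineChart.dom_mem_nhds hp)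
  refine ⟨δ, hδ, hd.mono fun y hy t ht W hW η hη => ?_⟩
  have hz : α (-t) y ∈ c.dom := hy _ (by rwa [abs_neg])
  have hy0 : y ∈ c.dom := by simpa using hy 0 (by simpa using hδ)
  have hN : ∀ w ∈ c.dom, c.dom ∩ τ ⁻¹' Metric.ball (τ w) (η / 2) ∈ 𝓝 w := fun w hw =>
    inter_mem (LineChart.dom_mem_nhds hw)
      ((hτ.continuousOn.continuousAt (LineChart.dom_mem_nhds hw)).preimage_mem_nhds
        (Metric.ball_mem_nhds _ (half_pos hη)))
  obtain ⟨U, hU, hyU, hUW⟩ := hsmall y _ (inter_mem hW (hN y hy0))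
  obtain ⟨V, hV, hzV, hVW⟩ := hsmall _ _ (hN _ hz)
  have hτz : τ (α (-t) y) = τ y - t := by
    have := hτ.time_orbit_eq (isPreconnected_abs_lt δ) hy (a := -t) (b := 0)
      (by simpa using ht) (by simpa using hδ)
    rw [α.map_zero_apply] at this
    linarith
  refine ⟨[U, c, V], by simp [hU, hc, hV], ?_, ?_⟩
  -- The curve waits at `y` on `[-1, 0]`, moves on `[0, 1]` and waits at its end on `[1, 2]`, since
  -- every chart of a chain needs an interval of positive length.
  · refine ⟨fun s => t * max 0 (min s 1), -1, 2, by norm_num, by fun_prop, by norm_num,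
      by norm_num, 0, by norm_num, fun s hs => ?_, 1, one_pos, fun s hs => ?_, 2, by norm_num,
      fun s hs => ?_, rfl⟩
    · beta_reduce
      rw [max_eq_left ((min_le_left _ _).trans hs.2)]
      simpa using hyU
    · refine hy _ ?_
      beta_reduce
      rw [min_eq_left hs.2, max_eq_right hs.1, abs_neg, abs_mul, abs_of_nonneg hs.1]
      exact (mul_le_of_le_one_right (abs_nonneg t) hs.2).trans_lt ht
    · beta_reduce
      rw [min_eq_right hs.1, max_eq_right zero_le_one, mul_one]
      exact hzV
  · rintro x u a b hu ⟨m, ham, h1, n, hmn, h2, b', hnb, h3, rfl⟩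
    have hmem : ∀ s ∈ Icc a b', α (-u s) x ∈ c.dom := fun s hs => by
      rcases le_total s m with hsm | hsm
      · exact (hUW (h1 s ⟨hs.1, hsm⟩)).2.1
      rcases le_total s n with hsn | hsn
      · exact h2 s ⟨hsm, hsn⟩
      · exact (hVW (h3 s ⟨hsn, hs.2⟩)).1
    have ha : a ∈ Icc a b' := ⟨le_rfl, by linarith⟩
    have hb : b' ∈ Icc a b' := ⟨by linarith, le_rfl⟩
    have key := hτ.time_orbit_eq (z := x) (isPreconnected_Icc.image _ hu.neg.continuousOn)
      (by
        rintro _ ⟨s, hs, rfl⟩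
        exact hmem s hs) (mem_image_of_mem _ ha) (mem_image_of_mem _ hb)
    have b1 := hUW (h1 a ⟨le_rfl, ham.le⟩)
    have b2 := hVW (h3 b' ⟨hnb.le, le_rfl⟩)
    refine ⟨b1.1, ?_⟩
    have d1 := b1.2.2
    have d2 := b2.2
    rw [mem_preimage, Metric.mem_ball, Real.dist_eq, abs_lt] at d1 d2
    rw [hτz] at d2
    rw [Pi.neg_apply, Pi.neg_apply] at key
    rw [abs_lt]
    constructor <;> linarith [d1.1, d1.2, d2.1, d2.2]

/-- Short chains can be appended in either time direction, so the truth value is locally constant in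
`t`. -/
theorem hasChain (hF : F.IsInducedBy α)
    (hsmall : ∀ y, ∀ W ∈ 𝓝 y, ∃ c ∈ F.charts, y ∈ c.dom ∧ c.dom ⊆ W) (y : Y) (t : ℝ) :
    HasChain F α y t := by
  have h0 : HasChain F α y 0 := by
    obtain ⟨δ, hδ, h⟩ := hF.eventually_hasChain hsmall y
    exact h.self_of_nhds 0 (by simpa using hδ)
  have := isPreconnected_univ.eq_of_eventually_eq (g := fun t : ℝ => HasChain F α y t)
    (fun t _ => nhdsWithin_le_nhds ?_) (mem_univ 0) (mem_univ t)
  · rwa [← this]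
  · obtain ⟨δ, hδ, h⟩ := hF.eventually_hasChain hsmall (α (-t) y)
    have hcont : Continuous fun r : ℝ => α (-r) y := α.continuous continuous_neg continuous_const
    filter_upwards [(hcont.tendsto t).eventually h, Metric.ball_mem_nhds t hδ] with r hr hrt
    rw [Metric.mem_ball, Real.dist_eq] at hrt
    -- Passing from `r` to `t` appends a chain that starts at `α (-r) y`, which is why `δ` must be
    -- uniform near `α (-t) y`.
    refine propext ⟨fun H => ?_, fun H => ?_⟩
    · have := HasChain.trans H (hr (t - r) (by rwa [abs_sub_comm]))
      rwa [add_sub_cancel] at this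
    · have := HasChain.trans H (h.self_of_nhds (r - t) hrt)
      rwa [add_sub_cancel] at this

/-- The chain set is an open neighbourhood of `π (y, t)`. Each of its elements is represented by a
curve whose starting point and total time lie in `W` and `I`, so it is the image of a point of `W ×ˢ
I`. -/
theorem isOpenMap_orbitArrow [T2Space Y] (hF : F.IsInducedBy α)
    (hsmall : ∀ y, ∀ W ∈ 𝓝 y, ∃ c ∈ F.charts, y ∈ c.dom ∧ c.dom ⊆ W) :
    IsOpenMap hF.orbitArrow := by
  refine IsOpenMap.of_nhds_le ?_
  rintro ⟨y, t⟩ S hS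
  rw [mem_map, nhds_prod_eq, Filter.mem_prod_iff] at hS
  obtain ⟨W, hW, I, hI, hWI⟩ := hS
  obtain ⟨η, hη, hηI⟩ := Metric.mem_nhds_iff.1 hI
  obtain ⟨L, hL, ⟨u, a, b, hab, hu, hua, hub, huL⟩, hL'⟩ := hF.hasChain hsmall y t W hW η hη
  have hopen : IsOpen (F.chainSet L.get) :=
    TopologicalSpace.isOpen_generateFrom_of_mem ⟨_, L.get, fun i => hL _ (L.get_mem i), rfl⟩
  refine mem_of_superset (hopen.mem_nhds (hF.orbitArrow_mem_chainSet.2 ?_)) ?_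
  · refine ⟨fun s => u ((b - a) * s + a), by fun_prop, by simp [hua], ?_, ?_⟩
    · simpa [hub] using Flow.IsLocalPeriod.zero y
    · rw [List.ofFn_get]
      have hba : 0 < b - a := sub_pos.2 hab
      have := huL.affine (m := (b - a)⁻¹) (q := -((b - a)⁻¹ * a))
        (g := fun s => α (-u ((b - a) * s + a)) y) (inv_pos.2 hba) (fun s => by
          congr 3
          field_simp
          ring)
      rwa [add_neg_cancel, ← sub_eq_add_neg, ← mul_sub, inv_mul_cancel₀ hba.ne'] at this
  · intro g hg
    obtain ⟨⟨y', t'⟩, rfl⟩ := hF.orbitArrow_surjective g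
    obtain ⟨v, hv, hv0, hp, h⟩ := hF.orbitArrow_mem_chainSet.1 hg
    rw [List.ofFn_get] at h
    obtain ⟨h1, h2⟩ := hL' y' v 0 1 hv h
    rw [hv0, neg_zero, α.map_zero_apply] at h1
    rw [hv0, sub_zero] at h2
    rw [← hF.orbitArrow_eq_iff.2 ⟨rfl, hp⟩]
    exact hWI (mk_mem_prod h1 (hηI h2))

theorem isLocalHomeomorph_orbitArrow [T2Space Y] (hF : F.IsInducedBy α)
    (hsmall : ∀ y, ∀ W ∈ 𝓝 y, ∃ c ∈ F.charts, y ∈ c.dom ∧ c.dom ⊆ W) :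
    IsLocalHomeomorph hF.orbitArrow := by
  rw [isLocalHomeomorph_iff_isOpenEmbedding_restrict]
  rintro ⟨y, t⟩
  obtain ⟨δ, hδ, h⟩ := hF.exists_forall_flow_ne y
  obtain ⟨W, hW, hWo, hyW⟩ := mem_nhds_iff.1 h
  -- Two times in this ball with the same arrow differ by a period smaller than `δ`, hence are
  -- equal.
  have hopen : IsOpen (W ×ˢ Metric.ball t (δ / 2)) := hWo.prod Metric.isOpen_ball
  refine ⟨_, hopen.mem_nhds ⟨hyW, Metric.mem_ball_self (half_pos hδ)⟩,
    .of_continuous_injective_isOpenMap (hF.continuous_orbitArrow.comp continuous_subtype_val) ?_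
      ((hF.isOpenMap_orbitArrow hsmall).comp hopen.isOpenMap_subtype_val)⟩
  rintro ⟨⟨x, r⟩, hx, hr⟩ ⟨⟨x', s⟩, hx', hs⟩ e
  obtain ⟨rfl, hp⟩ := hF.orbitArrow_eq_iff.1 e
  rw [Metric.mem_ball, Real.dist_eq, abs_lt] at hr hs
  have : r - s = 0 := hW hx (r - s) (by
    rw [abs_lt]
    constructor <;> linarith [hr.1, hr.2, hs.1, hs.2]) hp.eq
  obtain rfl : r = s := sub_eq_zero.1 this
  rfl

end IsInducedBy

end LineFoliation

/-! ### Topological groupoid axioms and their transfer along `π` -/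

theorem transformationGroupoid_isTopologicalGroupoid {Y : Type u} [TopologicalSpace Y]
    (α : Flow ℝ Y) : (transformationGroupoid α).IsTopologicalGroupoid where
  d_mem p := by simp [transformationGroupoid, GroupoidData.unitSpace]
  r_mem p := by simp [transformationGroupoid, GroupoidData.unitSpace]
  d_mul p q h := by
    have h : α (-p.2) p.1 = q.1 := congrArg Prod.fst h
    change (α (-(p.2 + q.2)) p.1, (0 : ℝ)) = (α (-q.2) q.1, 0)
    rw [← h, α.apply_apply]
    congr 2
    ring
  r_mul p q h := rfl
  unit_mul p h := by simp [transformationGroupoid]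
  mul_unit p h := by simp [transformationGroupoid]
  mul_assoc p q r h₁ h₂ h₃ h₄ := by simp [transformationGroupoid, add_assoc]
  d_inv p := by simp [transformationGroupoid, α.apply_apply]
  r_inv p := rfl
  inv_mul p h := by simp [transformationGroupoid]
  mul_inv p h := by simp [transformationGroupoid]
  continuous_mul := by
    change Continuous fun p : {p : (Y × ℝ) × Y × ℝ // _} => (p.1.1.1, p.1.1.2 + p.1.2.2)
    fun_prop
  continuous_inv := by
    change Continuous fun p : Y × ℝ => (α (-p.2) p.1, -p.2)
    exact (α.continuous continuous_snd.neg continuous_fst).prodMk continuous_snd.neg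

/-- A homomorphism which is open, continuous, surjective and injective on units makes its target
a topological groupoid. -/
theorem GroupoidData.IsTopologicalGroupoid.of_surjective {G : Type u} {H : Type v}
    [TopologicalSpace G] [TopologicalSpace H] {A : GroupoidData G} {B : GroupoidData H}
    (hA : A.IsTopologicalGroupoid) {π : G → H} (hd : ∀ x, π (A.d x) = B.d (π x))
    (hr : ∀ x, π (A.r x) = B.r (π x)) (hi : ∀ x, π (A.inv x) = B.inv (π x))
    (hm : ∀ x y (h : A.d x = A.r y) (h' : B.d (π x) = B.r (π y)),
      π (A.mul x y h) = B.mul (π x) (π y) h')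
    (hinj : InjOn π A.unitSpace) (hs : Function.Surjective π) (hc : Continuous π)
    (ho : IsOpenMap π) : B.IsTopologicalGroupoid := by
  -- Injectivity on units lifts composable pairs to composable pairs; every identity in `B` then
  -- comes from one in `A`.
  have hcomp : ∀ {x y}, B.d (π x) = B.r (π y) → A.d x = A.r y := fun {x y} h =>
    hinj (hA.d_mem x) (hA.r_mem y) (by rw [hd, hr, h])
  have hu : ∀ {x}, x ∈ A.unitSpace → π x ∈ B.unitSpace := fun {x} hx =>
    ⟨by rw [← hd, hx.1], by rw [← hr, hx.2]⟩
  refine ⟨?_, ?_, ?_, ?_, ?_, ?_, ?_, ?_, ?_, ?_, ?_, ?_, ?_⟩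
  · refine hs.forall.2 fun x => ?_
    rw [← hd]
    exact hu (hA.d_mem x)
  · refine hs.forall.2 fun x => ?_
    rw [← hr]
    exact hu (hA.r_mem x)
  · refine hs.forall.2 fun x => hs.forall.2 fun y h => ?_
    rw [← hm x y (hcomp h), ← hd, hA.d_mul, hd]
  · refine hs.forall.2 fun x => hs.forall.2 fun y h => ?_
    rw [← hm x y (hcomp h), ← hr, hA.r_mul, hr]
  · refine hs.forall.2 fun x h => ?_
    have key : ∀ e (he : π (A.r x) = e) (h : B.d e = B.r (π x)), B.mul e (π x) h = π x := by
      rintro _ rfl h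
      rw [← hm _ _ (hcomp h), hA.unit_mul]
    exact key _ (hr x) h
  · refine hs.forall.2 fun x h => ?_
    have key : ∀ e (he : π (A.d x) = e) (h : B.d (π x) = B.r e), B.mul (π x) e h = π x := by
      rintro _ rfl h
      rw [← hm _ _ (hcomp h), hA.mul_unit]
    exact key _ (hd x) h
  · refine hs.forall.2 fun x => hs.forall.2 fun y => hs.forall.2 fun z hxy hyz h₁ h₂ => ?_
    have key : ∀ e f (he : π (A.mul x y (hcomp hxy)) = e) (hf : π (A.mul y z (hcomp hyz)) = f)
        (h₁ : B.d e = B.r (π z)) (h₂ : B.d (π x) = B.r f),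
        B.mul e (π z) h₁ = B.mul (π x) f h₂ := by
      rintro _ _ rfl rfl h₁ h₂
      rw [← hm _ _ (hcomp h₁), ← hm _ _ (hcomp h₂), hA.mul_assoc]
    exact key _ _ (hm _ _ _ _) (hm _ _ _ _) h₁ h₂
  · refine hs.forall.2 fun x => ?_
    rw [← hi, ← hd, hA.d_inv, hr]
  · refine hs.forall.2 fun x => ?_
    rw [← hi, ← hr, hA.r_inv, hd]
  · refine hs.forall.2 fun x h => ?_
    have key : ∀ e (he : π (A.inv x) = e) (h : B.d e = B.r (π x)),
        B.mul e (π x) h = B.d (π x) := by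
      rintro _ rfl h
      rw [← hm _ _ (hcomp h), hA.inv_mul, hd]
    exact key _ (hi x) h
  · refine hs.forall.2 fun x h => ?_
    have key : ∀ e (he : π (A.inv x) = e) (h : B.d (π x) = B.r e),
        B.mul (π x) e h = B.r (π x) := by
      rintro _ rfl h
      rw [← hm _ _ (hcomp h), hA.mul_inv, hr]
    exact key _ (hi x) h
  · let S : Set (H × H) := {p | B.d p.1 = B.r p.2}
    -- An open quotient map restricts to one over any subset of the target, here over the composable
    -- pairs, so continuity can be tested upstairs.
    have hq : IsOpenQuotientMap (S.restrictPreimage (Prod.map π π)) :=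
      ⟨(hs.prodMap hs).restrictPreimage S, (hc.prodMap hc).restrictPreimage,
        (ho.prodMap ho).restrictPreimage S⟩
    refine hq.isQuotientMap.continuous_iff.2 ?_
    have hcont : Continuous fun p : Prod.map π π ⁻¹' S =>
        (⟨p.1, hcomp p.2⟩ : {p : G × G // A.d p.1 = A.r p.2}) :=
      continuous_subtype_val.subtype_mk _
    refine (hc.comp (hA.continuous_mul.comp hcont)).congr fun p => ?_
    exact hm _ _ _ _
  · have hq : IsOpenQuotientMap π := ⟨hs, hc, ho⟩
    refine hq.isQuotientMap.continuous_iff.2 ?_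
    exact (hc.comp hA.continuous_inv).congr hi

/-! ### The covering onto the holonomy groupoid -/

namespace LineFoliation.IsInducedBy

variable {Y : Type u} [TopologicalSpace Y] {F : LineFoliation Y} {α : Flow ℝ Y}

theorem orbitArrow_zero (hF : F.IsInducedBy α) (y : Y) :
    hF.orbitArrow (y, 0) = ⟨y, y, HolonomyClass.const F y⟩ :=
  (hF.mk_eq_orbitArrow (IsLeafPath.refl y) (u := fun _ => 0) continuous_const rfl
    (fun _ _ => by simp)).symm

theorem orbitArrow_d (hF : F.IsInducedBy α) (p : Y × ℝ) :
    hF.orbitArrow ((transformationGroupoid α).d p) = F.holonomyGroupoid.d (hF.orbitArrow p) :=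
  hF.orbitArrow_zero _

theorem orbitArrow_r (hF : F.IsInducedBy α) (p : Y × ℝ) :
    hF.orbitArrow ((transformationGroupoid α).r p) = F.holonomyGroupoid.r (hF.orbitArrow p) :=
  hF.orbitArrow_zero _

theorem orbitArrow_inv (hF : F.IsInducedBy α) (p : Y × ℝ) :
    hF.orbitArrow ((transformationGroupoid α).inv p) =
      F.holonomyGroupoid.inv (hF.orbitArrow p) := by
  have h := hF.mk_eq_orbitArrow (hF.isLeafPath_orbitPath p.1 p.2).symm (u := fun s => -p.2 * s)
    (by fun_prop) (by simp) (fun s hs => by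
      rw [Path.extend_symm_apply, extend_orbitPath α p.1 p.2 (1 - s)
        ⟨by linarith [hs.2], by linarith [hs.1]⟩, α.apply_apply]
      congr 1
      ring)
  rw [mul_one] at h
  exact h.symm

theorem orbitArrow_mul (hF : F.IsInducedBy α) (p q : Y × ℝ)
    (h : (transformationGroupoid α).d p = (transformationGroupoid α).r q)
    (h' : F.holonomyGroupoid.d (hF.orbitArrow p) = F.holonomyGroupoid.r (hF.orbitArrow q)) :
    hF.orbitArrow ((transformationGroupoid α).mul p q h) =
      F.holonomyGroupoid.mul (hF.orbitArrow p) (hF.orbitArrow q) h' := by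
  obtain ⟨y, t⟩ := p
  obtain ⟨z, s⟩ := q
  obtain rfl : α (-t) y = z := congrArg Prod.fst h
  have hl : ∀ r ∈ Icc (0 : ℝ) 1, ((orbitPath α y t).trans (orbitPath α (α (-t) y) s)).extend r =
      α (-glue (1 / 2) (fun r => t * (2 * r)) (fun r => s * (2 * r - 1)) r) y := fun r hr => by
    rcases le_total r (1 / 2) with h | h
    · rw [glue_of_le h, Path.extend_trans_of_le_half _ _ h,
        extend_orbitPath α _ _ _ ⟨by linarith [hr.1], by linarith⟩]
    · rw [glue_of_ge h, Path.extend_trans_of_half_le _ _ h,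
        extend_orbitPath α _ _ _ ⟨by linarith, by linarith [hr.2]⟩, α.apply_apply]
      congr 1
      ring
  have key := hF.mk_eq_orbitArrow
    ((hF.isLeafPath_orbitPath y t).trans (hF.isLeafPath_orbitPath (α (-t) y) s))
    (continuous_glue _ (by fun_prop) (by fun_prop))
    (by rw [glue_of_le (by norm_num)]; ring) hl
  rw [glue_of_ge (by norm_num)] at key
  have e : s * (2 * 1 - 1) + (t * (2 * (1 / 2)) - s * (2 * (1 / 2) - 1)) = t + s := by ring
  rw [e] at key
  exact key.symm

theorem mem_unitSpace_iff (hF : F.IsInducedBy α) {g : F.HolonomyGroupoid} :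
    g ∈ F.holonomyGroupoid.unitSpace ↔ g = hF.orbitArrow (g.range, 0) := by
  rw [hF.orbitArrow_zero]
  constructor
  · rintro ⟨-, h⟩
    exact h.symm
  · intro h
    rw [h]
    exact ⟨rfl, rfl⟩

theorem isFiberwiseGroupoidCovering [T2Space Y] (hF : F.IsInducedBy α)
    (hsmall : ∀ y, ∀ W ∈ 𝓝 y, ∃ c ∈ F.charts, y ∈ c.dom ∧ c.dom ⊆ W) :
    IsFiberwiseGroupoidCovering (transformationGroupoid α) F.holonomyGroupoid hF.orbitArrow := by
  have hA := transformationGroupoid_isTopologicalGroupoid α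
  have hc := hF.continuous_orbitArrow
  have ho := hF.isOpenMap_orbitArrow hsmall
  have hunit : ∀ p ∈ (transformationGroupoid α).unitSpace, p = (p.1, 0) := fun p hp => hp.2.symm
  have hq : IsOpenQuotientMap hF.orbitArrow := ⟨hF.orbitArrow_surjective, hc, ho⟩
  -- Composed with the quotient map `π`, the range is the first projection. This yields continuity
  -- of the inverse `g ↦ (g.range, 0)` on units.
  have hrange : Continuous (HolonomyGroupoid.range : F.HolonomyGroupoid → Y) :=
    hq.isQuotientMap.continuous_iff.2 continuous_fst
  refine ⟨hA, hA.of_surjective hF.orbitArrow_d hF.orbitArrow_r hF.orbitArrow_inv hF.orbitArrow_mul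
    ?_ hF.orbitArrow_surjective hc ho, hF.orbitArrow_d, hF.orbitArrow_r, hF.orbitArrow_mul, ?_,
    hF.orbitArrow_surjective, hF.isLocalHomeomorph_orbitArrow hsmall⟩
  · intro p hp q hq e
    rw [hunit p hp, hunit q hq] at e ⊢
    rw [(hF.orbitArrow_eq_iff.1 e).1]
  · refine ⟨⟨⟨fun p => ⟨hF.orbitArrow p, ?_⟩, fun g => ⟨(g.1.range, 0), ?_⟩, ?_, ?_⟩, ?_, ?_⟩,
      fun _ => rfl⟩
    · rw [hF.mem_unitSpace_iff, hunit p p.2]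
      rfl
    · simp [transformationGroupoid, GroupoidData.unitSpace]
    · exact fun p => Subtype.ext (hunit p p.2).symm
    · exact fun g => Subtype.ext (hF.mem_unitSpace_iff.1 g.2).symm
    · exact (hc.comp continuous_subtype_val).subtype_mk _
    · exact ((hrange.comp continuous_subtype_val).prodMk continuous_const).subtype_mk _

end LineFoliation.IsInducedBy

theorem mainTheorem7 {Y : Type u} [TopologicalSpace Y] [LocallyCompactSpace Y]
    [TopologicalSpace.MetrizableSpace Y] (α : Flow ℝ Y) (hα : ∀ y : Y, ∃ t : ℝ, α t y ≠ y) :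
    ∃ hA : IsFoliatedAtlas (openTubeCharts α),
      ∃ hleaf : ∀ (y : Y) (t : ℝ), hA.foliation.IsLeafPath (orbitPath α y t),
        IsFiberwiseGroupoidCovering (transformationGroupoid α) hA.foliation.holonomyGroupoid
          (fun p : Y × ℝ =>
            ⟨p.1, α (-p.2) p.1,
              hA.foliation.holonomyClass (orbitPath α p.1 p.2) (hleaf p.1 p.2)⟩) := by
  have hA := isFoliatedAtlas_openTubeCharts hα
  have hF := hA.isInducedBy
  refine ⟨hA, hF.isLeafPath_orbitPath, hF.isFiberwiseGroupoidCovering fun y W hW => ?_⟩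
  obtain ⟨c, hc, hy, hcW⟩ := exists_mem_openTubeCharts hα y hW
  exact ⟨c, hA.coherent c hc, hy, hcW⟩
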